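/- Let $(\mathcal H,d)$ be a separable metric space with its Borel $\sigma$-algebra, let $K\ge 2$, let $X$ be a random element of $\mathcal H$ and let $Y$ be a random variable with values in $\{1,\dots,K\}$. Let $Q_k$ be measurable functions on $\mathcal H$ with $Q_k(X)=P(Y=k\mid X)$ almost surely, $k=1,\dots,K$, and put $$f(x,u)=\min\Big\{k\in\{1,\dots,K\}:\ \sum_{j=1}^kQ_j(x)>u\Big\},\qquad u\in(0,1),$$ which is well defined for $P_X$-almost all $x$. Let $U,U'$ be uniformly distributed on $(0,1)$ with $X,U,U'$ independent. The pair $(X,f(X,U))$ has the law of $(X,Y)$, so assume $Y=f(X,U)$, and put $Y'=f(X,U')$. With $p_{i,j}=P(Y=i,Y'=j)$, $p_i=P(Y=i)$, $q_j=P(Y'=j)$ define $$\psi(X,Y)=\frac1{K-1}\sum_{i,j=1}^K\frac{(p_{i,j}-p_iq_j)^2}{p_iq_j}.$$ Let $(X_1,Y_1),(X_2,Y_2),\dots$ be i.i.d. copies of $(X,Y)$. For $n\ge2$ and $i\le n$ let $N(i)=N_n(i)\in\{1,\dots,n\}\setminus\{i\}$ be the index of the nearest neighbour of $X_i$ among $\{X_j: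 j\le n,\ j\ne i\}$ with respect to $d$; it is assumed that, almost surely, nearest neighbours are unique. Put $$\widehat p_{k,l}=\frac1n\sum_{i=1}^n1\{Y_i=k,\,Y_{N(i)}=l\},\quad \widehat p_k=\sum_{l=1}^K\widehat p_{k,l},\quad \widehat q_l=\sum_{k=1}^K\widehat p_{k,l},\quad \widehat\psi_n(X,Y)=\frac1{K-1}\sum_{k,l=1}^K\frac{(\widehat p_{k,l}-\widehat p_k\widehat q_l)^2}{\widehat p_k\widehat q_l}.$$ Summands with denominator $0$, in $\psi$ and in $\widehat\psi_n$, are read as $0$. Let $L_n=\max_{1\le i\le n}\#\{j\le n: N(j)=i\}$ be the maximal in-degree of the nearest-neighbour graph of $X_1,\dots,X_n$. **Theorem.** Assume that one of the following two conditions holds: (a) for almost all $u\in(0,1)$, $f(X_{N(1)},u)\to f(X_1,u)$ in probability as $n\to\infty$; (b) for every $k=1,\dots,K$, the function $Q_k$ is continuous at $P_X$-almost every point of $\mathcal H$. Assume moreover that there is a sequence of real numbers $(k_n)$ such that $$\sum_{n\ge1}P(L_n\ge k_n)<\infty,\qquad k_nP(L_n\ge k_n)\to0\qquad\text{and}\qquad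 k_n=o\big(\sqrt{n/\log n}\big).$$ Then $\widehat\psi_n(X,Y)\to\psi(X,Y)$ almost surely as $n\to\infty$. -/

import Mathlib

open MeasureTheory ProbabilityTheory Filter Topology Asymptotics
open scoped BigOperators

noncomputable section

namespace NNDependence

/-- `Q 1, …, Q K` is a version of the conditional probabilities of the levels:
`Q k` is measurable and `Q k (X) = P(Y = k | X)` almost surely. -/
def IsCondProb {Ω H : Type*} [MeasurableSpace Ω] [mH : MeasurableSpace H]
    (P : Measure Ω) (X : Ω → H) (Y : Ω → ℕ) (K : ℕ) (Q : ℕ → H → ℝ) : Prop :=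
  ∀ k ∈ Finset.Icc 1 K, Measurable (Q k) ∧
    (fun ω => Q k (X ω)) =ᵐ[P]
      P[{ω | Y ω = k}.indicator (fun _ => (1 : ℝ)) | MeasurableSpace.comap X mH]

/-- `f(x,u) = min {k ∈ {1,…,K} : Q 1 x + ⋯ + Q k x > u}`. -/
def levelMap {H : Type*} (K : ℕ) (Q : ℕ → H → ℝ) (x : H) (u : ℝ) : ℕ :=
  sInf {k : ℕ | k ∈ Finset.Icc 1 K ∧ u < ∑ j ∈ Finset.Icc 1 k, Q j x}

/-- The uniform distribution on `(0,1)`. -/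
def unif : Measure ℝ := volume.restrict (Set.Ioo 0 1)

/-- The law of `(X, U, U')` with `X ∼ μ`, with `U, U'` uniform on `(0,1)`,
and with `X, U, U'` independent. -/
def couplingLaw {H : Type*} [MeasurableSpace H] (μ : Measure H) : Measure (H × ℝ × ℝ) :=
  μ.prod (unif.prod unif)

/-- `V = (1/(K-1)) ∑_{i,j} (p_{i,j} - r_i s_j)² / (r_i s_j)`, for the cell probabilities `p`
and the marginal probabilities `r`, `s` of two variables with levels `1,…,K`. -/
def cramerV (K : ℕ) (p : ℕ → ℕ → ℝ) (r s : ℕ → ℝ) : ℝ :=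
  1 / ((K : ℝ) - 1) *
    ∑ i ∈ Finset.Icc 1 K, ∑ j ∈ Finset.Icc 1 K, (p i j - r i * s j) ^ 2 / (r i * s j)

/-- The dependence coefficient `ψ(X,Y) = V(Y,Y')`, where `Y = f(X,U)` and `Y' = f(X,U')`;
here `μ` is the law of `X` and `Q` are the conditional probabilities of `Y` given `X`. -/
def psi {H : Type*} [MeasurableSpace H] (K : ℕ) (μ : Measure H) (Q : ℕ → H → ℝ) : ℝ :=
  cramerV K
    (fun i j => (couplingLaw μ).real
      {z | levelMap K Q z.1 z.2.1 = i ∧ levelMap K Q z.1 z.2.2 = j})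
    (fun i => (couplingLaw μ).real {z | levelMap K Q z.1 z.2.1 = i})
    (fun j => (couplingLaw μ).real {z | levelMap K Q z.1 z.2.2 = j})

/-- Among the first `n` points `x 0, …, x (n-1)`, the point with index `j` is a nearest
neighbour of the point with index `i`. -/
def IsNearest {H : Type*} [MetricSpace H] (n : ℕ) (x : ℕ → H) (i j : ℕ) : Prop :=
  j < n ∧ j ≠ i ∧ ∀ m < n, m ≠ i → dist (x i) (x j) ≤ dist (x i) (x m)

/-- Every one of the first `n` points has exactly one nearest neighbour among the others. -/
def UniqueNearest {H : Type*} [MetricSpace H] (n : ℕ) (x : ℕ → H) : Prop :=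
  ∀ i < n, ∃! j, IsNearest n x i j

/-- The index `N(i)` of the nearest neighbour of the point with index `i` among the first `n`
points (the smallest such index; no choice is involved when the nearest neighbour is unique). -/
def nn {H : Type*} [MetricSpace H] (n : ℕ) (x : ℕ → H) (i : ℕ) : ℕ :=
  sInf {j : ℕ | IsNearest n x i j}

/-- The in-degree `L_{i,n}` of the vertex `i` in the nearest neighbour graph. -/
def inDegree {H : Type*} [MetricSpace H] (n : ℕ) (x : ℕ → H) (i : ℕ) : ℕ :=
  ((Finset.range n).filter (fun j => nn n x j = i)).card

/-- The maximal in-degree `L_n` of the nearest neighbour graph. -/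
def maxInDegree {H : Type*} [MetricSpace H] (n : ℕ) (x : ℕ → H) : ℕ :=
  (Finset.range n).sup (inDegree n x)

/-- `p̂_{k,l} = (1/n) ∑_i 1{Y_i = k, Y_{N(i)} = l}`. -/
def pHat {H : Type*} [MetricSpace H] (n : ℕ) (x : ℕ → H) (y : ℕ → ℕ) (k l : ℕ) : ℝ :=
  1 / (n : ℝ) * ∑ i ∈ Finset.range n, if y i = k ∧ y (nn n x i) = l then (1 : ℝ) else 0

/-- The estimator `ψ̂(X,Y)` computed from `(x 0, y 0), …, (x (n-1), y (n-1))`. -/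
def psiHat {H : Type*} [MetricSpace H] (K n : ℕ) (x : ℕ → H) (y : ℕ → ℕ) : ℝ :=
  cramerV K (pHat n x y)
    (fun k => ∑ l ∈ Finset.Icc 1 K, pHat n x y k l)
    (fun l => ∑ k ∈ Finset.Icc 1 K, pHat n x y k l)

/-- For almost all `u ∈ (0,1)`, `f(X_{N(1)}, u) → f(X_1, u)` in probability as `n → ∞`.
The first sample point has index `0`. -/
def CondA {Ω H : Type*} [MeasurableSpace Ω] [MetricSpace H]
    (P : Measure Ω) (K : ℕ) (Q : ℕ → H → ℝ) (X : ℕ → Ω → H) : Prop :=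
  ∀ᵐ u ∂unif, TendstoInMeasure P
    (fun (n : ℕ) ω => (levelMap K Q (X (nn n (fun i => X i ω) 0) ω) u : ℝ)) atTop
    (fun ω => (levelMap K Q (X 0 ω) u : ℝ))

/-- For `k = 1,…,K`, the function `Q k` is continuous at `μ`-almost every point. -/
def CondB {H : Type*} [MetricSpace H] [MeasurableSpace H]
    (μ : Measure H) (K : ℕ) (Q : ℕ → H → ℝ) : Prop :=
  ∀ k ∈ Finset.Icc 1 K, ∀ᵐ x ∂μ, ContinuousAt (Q k) x

end NNDependence

end

/-! The coefficient is a continuous function of cell and marginal probabilities, so it suffices that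
`pHat` converges almost surely, cell by cell, to `∫ Q a * Q b ∂μ`. This integral is the cell
probability of `(Y, Y')`, because the two levels are conditionally independent given `X`, each with
weights `Q`. The limits of the marginals follow by summing over cells. If a denominator vanishes in
the limit, the level concerned almost surely never occurs in the sample, so the corresponding
summands are `0` for every `n`.

Means. By exchangeability, the mean of `pHat` is the probability that the first point has level `a`
and its neighbour has level `b`. The graph depends only on the `X`'s, so conditioning turns this
into `E[Q a (X 0) * Q b (X (N 0))]` (`measure_level_nn_zero`). It remains to see that `Q b (X (N
0))` converges to `Q b (X 0)` in `L¹`. Under (b) this follows from continuity and convergence of the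
nearest neighbour to its point; under (a) it holds because `Q b x` is the length of `{u | f(x,u) =
b}`.

Fluctuations. Resampling the points in `D` changes `pHat` by at most `(1 + 2κ)|D|/n`, provided both
maximal in-degrees are at most `κ` (`abs_pHat_sub_le`). Since this bound fails on an exceptional
event, the sample is compared with an independent copy. Exchanging an arbitrary set `s` of
coordinates preserves the joint law, and for fixed samples `pHat` becomes a function of `s` on the
discrete cube, Lipschitz at the good vertices. Extending it to a Lipschitz function on the whole
cube and applying a Chernoff bound to its difference at opposite vertices gives a Gaussian tail plus
`2 P(B)`, where `B` is the exceptional event (`measure_copy_le`). A median-type argument replaces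
the copy by the limit (`measure_dev_le`). The rate of `k` makes the tails summable, and
Borel–Cantelli concludes. -/

namespace NNDependence

/-! ### Concentration on the discrete cube. -/

section Cube

variable {ι : Type*} [DecidableEq ι]

/-- Exponential moment bound for a function on the cube of subsets of `T` which changes by at
most `c` when one element is inserted. -/
lemma sum_powerset_exp_le (T : Finset ι) (c : ℝ) : ∀ (f : Finset ι → ℝ),
    (∀ s a, |f (insert a s) - f s| ≤ c) →
    ∑ s ∈ T.powerset, Real.exp (f s) ≤
      2 ^ T.card * Real.exp ((∑ s ∈ T.powerset, f s) / 2 ^ T.card + T.card * c ^ 2 / 8) := by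
  induction T using Finset.induction_on with
  | empty => intro f _; simp
  | insert a T ha ih =>
    intro f hf
    -- Hoeffding's lemma for a two-point law: once the midpoint is factored out, a hyperbolic cosine
    -- remains.
    have hpair : ∀ x y : ℝ, |y - x| ≤ c →
        Real.exp x + Real.exp y ≤ 2 * Real.exp (c ^ 2 / 8) * Real.exp ((x + y) / 2) := by
      intro x y hxy
      have h1 : Real.exp x + Real.exp y
          = 2 * Real.exp ((x + y) / 2) * Real.cosh ((y - x) / 2) := by
        rw [Real.cosh_eq, show x = (x + y) / 2 + -((y - x) / 2) by ring,
          show y = (x + y) / 2 + ((y - x) / 2) by ring, Real.exp_add, Real.exp_add]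
        ring_nf
      have h2 : Real.cosh ((y - x) / 2) ≤ Real.exp (c ^ 2 / 8) := by
        refine (Real.cosh_le_exp_half_sq _).trans (Real.exp_le_exp.2 ?_)
        have : (y - x) ^ 2 ≤ c ^ 2 := sq_le_sq' (by linarith [neg_abs_le (y - x)])
          ((le_abs_self _).trans hxy)
        linarith
      rw [h1]
      nlinarith [mul_le_mul_of_nonneg_left h2 (Real.exp_pos ((x + y) / 2)).le]
    -- Averaging over the presence of `a` keeps the mean over the cube and the increment bound `c`.
    have hg := ih (fun s => (f s + f (insert a s)) / 2) (by
      intro s b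
      have h1 := hf s b
      have h2 := hf (insert a s) b
      rw [Finset.insert_comm] at h2
      rw [show (f (insert b s) + f (insert a (insert b s))) / 2 - (f s + f (insert a s)) / 2
        = (f (insert b s) - f s) / 2 + (f (insert a (insert b s)) - f (insert a s)) / 2 by ring]
      rw [abs_le] at *
      constructor <;> linarith [h1.1, h1.2, h2.1, h2.2])
    rw [Finset.sum_powerset_insert ha, Finset.sum_powerset_insert ha, ← Finset.sum_add_distrib,
      ← Finset.sum_add_distrib, Finset.card_insert_of_notMem ha]
    calc ∑ s ∈ T.powerset, (Real.exp (f s) + Real.exp (f (insert a s)))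
        ≤ ∑ s ∈ T.powerset,
            2 * Real.exp (c ^ 2 / 8) * Real.exp ((f s + f (insert a s)) / 2) :=
          Finset.sum_le_sum fun s _ => hpair _ _ (hf s a)
      _ ≤ 2 * Real.exp (c ^ 2 / 8) * (2 ^ T.card * Real.exp
            ((∑ s ∈ T.powerset, (f s + f (insert a s)) / 2) / 2 ^ T.card
              + T.card * c ^ 2 / 8)) := by
          rw [← Finset.mul_sum]
          exact mul_le_mul_of_nonneg_left hg (by positivity)
      _ = _ := by
          rw [← Finset.sum_div, mul_mul_mul_comm, ← Real.exp_add, ← pow_succ']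
          have : ∀ S : ℝ, c ^ 2 / 8 + (S / 2 / 2 ^ T.card + T.card * c ^ 2 / 8)
              = S / 2 ^ (T.card + 1) + ((T.card + 1 : ℕ) : ℝ) * c ^ 2 / 8 := by
            intro S
            rw [pow_succ]
            push_cast
            field_simp
            ring
          rw [this]

/-- Chernoff bound on the cube of subsets of `T`. -/
lemma card_filter_powerset_le (T : Finset ι) {c t : ℝ} (hc : 0 < c) (ht : 0 < t)
    (hT : T.Nonempty) (h : Finset ι → ℝ) (hlip : ∀ s a, |h (insert a s) - h s| ≤ 2 * c)
    (hmean : ∑ s ∈ T.powerset, h s = 0) :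
    ((T.powerset.filter fun s => t < h s).card : ℝ) ≤
      2 ^ T.card * Real.exp (-(t ^ 2 / (2 * T.card * c ^ 2))) := by
  have hn : (0 : ℝ) < T.card := by exact_mod_cast hT.card_pos
  -- Minimiser of the Chernoff exponent `T.card * r ^ 2 * c ^ 2 / 2 - r * t`.
  set r : ℝ := t / (T.card * c ^ 2) with hr
  have hr0 : 0 < r := by positivity
  have key := sum_powerset_exp_le T (r * (2 * c)) (fun s => r * h s) (by
    intro s a
    rw [← mul_sub, abs_mul, abs_of_pos hr0]
    exact mul_le_mul_of_nonneg_left (hlip s a) hr0.le)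
  rw [← Finset.mul_sum, hmean] at key
  have h1 : ((T.powerset.filter fun s => t < h s).card : ℝ) * Real.exp (r * t)
      ≤ ∑ s ∈ T.powerset, Real.exp (r * h s) := by
    calc _ = ∑ s ∈ T.powerset.filter (fun s => t < h s), Real.exp (r * t) := by simp
      _ ≤ ∑ s ∈ T.powerset.filter (fun s => t < h s), Real.exp (r * h s) := by
          refine Finset.sum_le_sum fun s hs => Real.exp_le_exp.2 ?_
          exact mul_le_mul_of_nonneg_left (Finset.mem_filter.1 hs).2.le hr0.le
      _ ≤ _ := Finset.sum_le_sum_of_subset_of_nonneg (Finset.filter_subset _ _)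
          fun _ _ _ => (Real.exp_pos _).le
  have h2 := (h1.trans key)
  rw [← le_div_iff₀ (Real.exp_pos _), mul_div_assoc, ← Real.exp_sub] at h2
  refine h2.trans_eq ?_
  congr 2
  rw [hr]
  field_simp
  ring

/-- A function on a finite cube which is Lipschitz on a subset agrees there with a function which
is Lipschitz everywhere. -/
lemma exists_lipschitz_extension [Fintype ι] {c : ℝ} (hc : 0 ≤ c) (f : Finset ι → ℝ)
    (A : Finset (Finset ι))
    (hf : ∀ s ∈ A, ∀ s' ∈ A, |f s - f s'| ≤ c * (symmDiff s s').card) :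
    ∃ g : Finset ι → ℝ, (∀ s ∈ A, g s = f s) ∧ ∀ s a, |g (insert a s) - g s| ≤ c := by
  rcases A.eq_empty_or_nonempty with rfl | hA
  · exact ⟨fun _ => 0, by simp, fun _ _ => by simpa using hc⟩
  -- McShane's extension for the Hamming distance `(symmDiff s s').card`.
  refine ⟨fun s => A.inf' hA fun s' => f s' + c * (symmDiff s s').card, ?_, ?_⟩
  · intro s hs
    apply le_antisymm
    · refine (Finset.inf'_le _ hs).trans ?_
      simp
    · refine Finset.le_inf' _ _ fun s' hs' => ?_
      linarith [le_abs_self (f s - f s'), hf s hs s' hs']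
  · have step : ∀ s s' : Finset ι, (symmDiff s s').card ≤ 1 →
        A.inf' hA (fun r => f r + c * (symmDiff s r).card) ≤
          A.inf' hA (fun r => f r + c * (symmDiff s' r).card) + c := by
      intro s s' hss
      obtain ⟨r, hr, hr'⟩ := Finset.exists_mem_eq_inf' hA
        (fun r => f r + c * ((symmDiff s' r).card : ℝ))
      rw [hr']
      refine (Finset.inf'_le _ hr).trans ?_
      have h1 : (symmDiff s r).card ≤ 1 + (symmDiff s' r).card := by
        calc (symmDiff s r).card ≤ (symmDiff s s' ∪ symmDiff s' r).card :=
              Finset.card_le_card (symmDiff_triangle s s' r)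
          _ ≤ _ := (Finset.card_union_le _ _).trans (by lia)
      have h2 : ((symmDiff s r).card : ℝ) ≤ 1 + (symmDiff s' r).card := by exact_mod_cast h1
      nlinarith [mul_le_mul_of_nonneg_left h2 hc]
    intro s a
    have hcard : (symmDiff (insert a s) s).card ≤ 1 := by
      refine (Finset.card_le_card (t := {a}) ?_).trans (by simp)
      intro b hb
      simp only [Finset.mem_symmDiff, Finset.mem_insert] at hb
      simp only [Finset.mem_singleton]
      tauto
    have h1 := step (insert a s) s hcard
    have h2 := step s (insert a s) (by rwa [symmDiff_comm])
    rw [abs_le]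
    constructor <;> linarith

/-- Comparison of a function at opposite points of the cube, for a function which is Lipschitz on
a subset of good points. -/
lemma card_filter_compl_le [Fintype ι] [Nonempty ι] {c t : ℝ} (hc : 0 < c) (ht : 0 < t)
    (f : Finset ι → ℝ) (A : Finset (Finset ι))
    (hf : ∀ s ∈ A, ∀ s' ∈ A, |f s - f s'| ≤ c * (symmDiff s s').card) :
    ((Finset.univ.filter fun s => t < |f s - f sᶜ|).card : ℝ) ≤
      (Finset.univ.filter fun s => s ∉ A).card + (Finset.univ.filter fun s => sᶜ ∉ A).card
      + 2 * (2 ^ Fintype.card ι * Real.exp (-(t ^ 2 / (2 * Fintype.card ι * c ^ 2)))) := by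
  obtain ⟨g, hgA, hg⟩ := exists_lipschitz_extension hc.le f A hf
  -- Inserting `a` into `s` deletes it from the complement, so the opposite value has the same
  -- increments; the difference of the two changes by at most `2 * c`.
  have hgc : ∀ s a, |g (insert a s)ᶜ - g sᶜ| ≤ c := by
    intro s a
    by_cases ha : a ∈ s
    · rw [Finset.insert_eq_of_mem ha]; simpa using hc.le
    · have : sᶜ = insert a (insert a s)ᶜ := by
        ext b; simp only [Finset.mem_compl, Finset.mem_insert]
        by_cases hb : b = a
        · subst hb; simpa using ha
        · simp [hb]
      rw [abs_sub_comm, this]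
      exact hg _ _
  -- Complementation permutes the cube, so the difference at opposite vertices has mean zero.
  have hsum : ∑ s : Finset ι, g sᶜ = ∑ s : Finset ι, g s :=
    Equiv.sum_comp (compl_involutive (α := Finset ι)).toPerm g
  have tri : ∀ x y x' y' : ℝ, |x' - x| ≤ c → |y' - y| ≤ c → |x' - y' - (x - y)| ≤ 2 * c := by
    intro x y x' y' h1 h2
    rw [abs_le] at *
    constructor <;> linarith [h1.1, h1.2, h2.1, h2.2]
  have b1 := card_filter_powerset_le (Finset.univ : Finset ι) hc ht Finset.univ_nonempty
    (fun s => g s - g sᶜ) (fun s a => tri _ _ _ _ (hg s a) (hgc s a))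
    (by simp [Finset.sum_sub_distrib, hsum])
  have b2 := card_filter_powerset_le (Finset.univ : Finset ι) hc ht Finset.univ_nonempty
    (fun s => g sᶜ - g s) (fun s a => tri _ _ _ _ (hgc s a) (hg s a))
    (by simp [Finset.sum_sub_distrib, hsum])
  rw [Finset.powerset_univ, Finset.card_univ] at b1 b2
  have hsub : (Finset.univ.filter fun s => t < |f s - f sᶜ|) ⊆
      ((Finset.univ.filter fun s => s ∉ A) ∪ (Finset.univ.filter fun s => sᶜ ∉ A)) ∪
      ((Finset.univ.filter fun s => t < g s - g sᶜ) ∪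
        (Finset.univ.filter fun s => t < g sᶜ - g s)) := by
    intro s hs
    simp only [Finset.mem_filter, Finset.mem_univ, true_and, Finset.mem_union] at hs ⊢
    by_cases h1 : s ∈ A
    · by_cases h2 : sᶜ ∈ A
      · rw [hgA s h1, hgA _ h2]
        rcases lt_abs.1 hs with h | h
        · exact Or.inr (Or.inl h)
        · exact Or.inr (Or.inr (by linarith))
      · exact Or.inl (Or.inr h2)
    · exact Or.inl (Or.inl h1)
  have hcard := ((Finset.card_le_card hsub).trans (Finset.card_union_le _ _)).trans
    (add_le_add (Finset.card_union_le _ _) (Finset.card_union_le _ _))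
  have hcard' : ((Finset.univ.filter fun s => t < |f s - f sᶜ|).card : ℝ) ≤
      ((Finset.univ.filter fun s => s ∉ A).card + (Finset.univ.filter fun s => sᶜ ∉ A).card)
      + ((Finset.univ.filter fun s => t < g s - g sᶜ).card +
        (Finset.univ.filter fun s => t < g sᶜ - g s).card) := by exact_mod_cast hcard
  linarith

end Cube

/-! ### Comparison with an independent copy. -/

section Ghost

variable {ι E : Type*} [Fintype ι] [DecidableEq ι] [MeasurableSpace E]

/-- Exchanging the coordinates in `s` between two independent samples preserves their law. -/
lemma measurePreserving_swap (ν : Measure E) [IsProbabilityMeasure ν] (s : Finset ι) :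
    MeasurePreserving
      (fun z : (ι → E) × (ι → E) => (s.piecewise z.2 z.1, s.piecewise z.1 z.2))
      ((Measure.pi fun _ => ν).prod (Measure.pi fun _ => ν))
      ((Measure.pi fun _ => ν).prod (Measure.pi fun _ => ν)) := by
  have e := measurePreserving_arrowProdEquivProdArrow E E ι (fun _ => ν) (fun _ => ν)
  -- Regrouped as a family of pairs, the exchange acts coordinatewise, by a swap or the identity,
  -- and each preserves `ν.prod ν`.
  have hsw : ∀ i : ι, MeasurePreserving
      (fun p : E × E => if i ∈ s then p.swap else p) (ν.prod ν) (ν.prod ν) := by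
    intro i
    by_cases hi : i ∈ s
    · simpa [hi] using Measure.measurePreserving_swap (μ := ν) (ν := ν)
    · simp only [hi, if_false]; exact MeasurePreserving.id (ν.prod ν)
  have hp := measurePreserving_pi (fun _ : ι => ν.prod ν) (fun _ : ι => ν.prod ν) hsw
  have := (e.comp hp).comp e.symm
  convert this using 1
  ext z i
  · by_cases hi : i ∈ s <;>
      simp [Finset.piecewise, hi, MeasurableEquiv.arrowProdEquivProdArrow,
        Equiv.arrowProdEquivProdArrow]
  · by_cases hi : i ∈ s <;>
      simp [Finset.piecewise, hi, MeasurableEquiv.arrowProdEquivProdArrow,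
        Equiv.arrowProdEquivProdArrow]

/-- Concentration around an independent copy, for a function of independent variables which has
bounded differences off an exceptional set `B`. -/
lemma measure_copy_le [Nonempty ι] (ν : Measure E) [IsProbabilityMeasure ν]
    (F : (ι → E) → ℝ) (hF : Measurable F) (B : Set (ι → E)) (hB : MeasurableSet B)
    {c t : ℝ} (hc : 0 < c) (ht : 0 < t)
    (hlip : ∀ z ∉ B, ∀ z' ∉ B, ∀ D : Finset ι, (∀ i ∉ D, z i = z' i) →
      |F z - F z'| ≤ c * D.card) :
    ((Measure.pi fun _ => ν).prod (Measure.pi fun _ => ν)).real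
        {z : (ι → E) × (ι → E) | t < |F z.1 - F z.2|} ≤
      2 * (Measure.pi fun _ : ι => ν).real B
        + 2 * Real.exp (-(t ^ 2 / (2 * Fintype.card ι * c ^ 2))) := by
  classical
  set M : Measure (ι → E) := Measure.pi fun _ => ν with hM
  set S : Set ((ι → E) × (ι → E)) := {z | t < |F z.1 - F z.2|} with hS
  have hSm : MeasurableSet S :=
    measurableSet_lt measurable_const
      ((hF.comp measurable_fst).sub (hF.comp measurable_snd)).abs
  set T : Finset ι → (ι → E) × (ι → E) → (ι → E) × (ι → E) :=
    fun s z => (s.piecewise z.2 z.1, s.piecewise z.1 z.2) with hT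
  have hTp : ∀ s, MeasurePreserving (T s) (M.prod M) (M.prod M) :=
    fun s => measurePreserving_swap ν s
  have hB1 : MeasurableSet (Prod.fst ⁻¹' B : Set ((ι → E) × (ι → E))) := measurable_fst hB
  have hB2 : MeasurableSet (Prod.snd ⁻¹' B : Set ((ι → E) × (ι → E))) := measurable_snd hB
  have hcompl : ∀ (s : Finset ι) (z : (ι → E) × (ι → E)),
      (sᶜ).piecewise z.2 z.1 = s.piecewise z.1 z.2 := fun s z => Finset.piecewise_compl _ _ _
  -- For fixed `z`, the two components of `T s z` are the mixed samples at the opposite vertices `s`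
  -- and `sᶜ`, so this is the count on the cube. A vertex is good if its mixed sample lies outside
  -- `B`.
  have hpt : ∀ z, ∑ s : Finset ι, (T s ⁻¹' S).indicator (fun _ => (1 : ℝ)) z ≤
      ∑ s : Finset ι, (T s ⁻¹' (Prod.fst ⁻¹' B)).indicator (fun _ => (1 : ℝ)) z
      + ∑ s : Finset ι, (T s ⁻¹' (Prod.snd ⁻¹' B)).indicator (fun _ => (1 : ℝ)) z
      + 2 * (2 ^ Fintype.card ι * Real.exp (-(t ^ 2 / (2 * Fintype.card ι * c ^ 2)))) := by
    intro z
    have key := card_filter_compl_le hc ht (fun s => F (s.piecewise z.2 z.1))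
      (Finset.univ.filter fun s => s.piecewise z.2 z.1 ∉ B) (by
        intro s hs s' hs'
        refine hlip _ (Finset.mem_filter.1 hs).2 _ (Finset.mem_filter.1 hs').2 _ ?_
        intro i hi
        rw [Finset.mem_symmDiff] at hi
        by_cases h1 : i ∈ s <;> by_cases h2 : i ∈ s' <;> simp [Finset.piecewise, h1, h2] at hi ⊢)
    simpa [Set.indicator_apply, hS, hT, hcompl, Finset.sum_boole] using key
  -- Every `T s` preserves the law, so each of the `2 ^ card ι` terms integrates to the same
  -- probability.
  have hsum : ∀ A : Set ((ι → E) × (ι → E)), MeasurableSet A →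
      ∫ z, ∑ s : Finset ι, (T s ⁻¹' A).indicator (fun _ => (1 : ℝ)) z ∂(M.prod M)
        = 2 ^ Fintype.card ι * (M.prod M).real A := by
    intro A hA
    rw [integral_finsetSum]
    · have : ∀ s, ∫ z, (T s ⁻¹' A).indicator (fun _ => (1 : ℝ)) z ∂(M.prod M)
          = (M.prod M).real A := by
        intro s
        rw [integral_indicator_const _ ((hTp s).measurable hA), smul_eq_mul, mul_one,
          measureReal_def, (hTp s).measure_preimage hA.nullMeasurableSet, measureReal_def]
      simp [this]
    · intro s _
      exact (integrable_const _).indicator ((hTp s).measurable hA)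
  have hint : ∀ A : Set ((ι → E) × (ι → E)), MeasurableSet A →
      Integrable (fun z => ∑ s : Finset ι, (T s ⁻¹' A).indicator (fun _ => (1 : ℝ)) z)
        (M.prod M) := fun A hA =>
    integrable_finsetSum _ fun s _ => (integrable_const _).indicator ((hTp s).measurable hA)
  have hmono := integral_mono (hint S hSm)
    (((hint _ hB1).add (hint _ hB2)).add (integrable_const _)) hpt
  have hadd := integral_add (hint _ hB1) (hint _ hB2)
  have hadd' := integral_add ((hint _ hB1).add (hint _ hB2)) (integrable_const
    (2 * (2 ^ Fintype.card ι * Real.exp (-(t ^ 2 / (2 * Fintype.card ι * c ^ 2))))))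
  simp only [Pi.add_apply] at hmono hadd hadd'
  rw [hsum S hSm, hadd', hadd, hsum _ hB1, hsum _ hB2] at hmono
  have e1 : (M.prod M).real (Prod.fst ⁻¹' B) = M.real B := by
    rw [measureReal_def, measurePreserving_fst.measure_preimage hB.nullMeasurableSet,
      measureReal_def]
  have e2 : (M.prod M).real (Prod.snd ⁻¹' B) = M.real B := by
    rw [measureReal_def, measurePreserving_snd.measure_preimage hB.nullMeasurableSet,
      measureReal_def]
  rw [e1, e2] at hmono
  simp only [integral_const, probReal_univ, smul_eq_mul, one_mul] at hmono
  have h2 : (0 : ℝ) < 2 ^ Fintype.card ι := by positivity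
  refine le_of_mul_le_mul_left (hmono.trans_eq ?_) h2
  ring

end Ghost

/-- A function of values in `[0,1]` which is close to an independent copy of itself, and whose mean
is close to `p`, is close to `p`. -/
lemma measure_dev_le {W : Type*} [MeasurableSpace W] (M : Measure W) [IsProbabilityMeasure M]
    (F : W → ℝ) (hF : Measurable F) (hF0 : ∀ z, F z ∈ Set.Icc (0 : ℝ) 1) {p t : ℝ} (ht : 0 < t)
    (h1 : (M.prod M).real {z : W × W | t / 16 < |F z.1 - F z.2|} ≤ t / 16)
    (h2 : |∫ z, F z ∂M - p| ≤ t / 8) :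
    M.real {z | t < |F z - p|} ≤ 2 * (M.prod M).real {z : W × W | t / 2 < |F z.1 - F z.2|} := by
  have hbd : ∀ x y, |F x - F y| ≤ 1 := fun x y => by
    rw [abs_le]; constructor <;> linarith [(hF0 x).1, (hF0 x).2, (hF0 y).1, (hF0 y).2]
  have hFi : Integrable F M :=
    Integrable.of_bound hF.aestronglyMeasurable 1 (Eventually.of_forall fun z => by
      rw [Real.norm_eq_abs, abs_le]; constructor <;> linarith [(hF0 z).1, (hF0 z).2])
  have hdm : Measurable fun z : W × W => |F z.1 - F z.2| :=
    ((hF.comp measurable_fst).sub (hF.comp measurable_snd)).abs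
  have hdi : Integrable (fun z : W × W => |F z.1 - F z.2|) (M.prod M) :=
    Integrable.of_bound hdm.aestronglyMeasurable 1 (Eventually.of_forall fun z => by
      simpa using hbd z.1 z.2)
  set S : Set (W × W) := {z | t / 16 < |F z.1 - F z.2|} with hS
  have hSm : MeasurableSet S := measurableSet_lt measurable_const hdm
  -- The difference is at most `t / 16` off `S` and at most `1` on `S`.
  have hE : ∫ z, |F z.1 - F z.2| ∂(M.prod M) ≤ t / 8 := by
    have : ∫ z, |F z.1 - F z.2| ∂(M.prod M)
        ≤ ∫ z, (t / 16 + S.indicator (fun _ => (1 : ℝ)) z) ∂(M.prod M) := by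
      refine integral_mono hdi ((integrable_const _).add
        ((integrable_const _).indicator hSm)) fun z => ?_
      by_cases hz : z ∈ S
      · simp only [Set.indicator_of_mem hz]
        linarith [hbd z.1 z.2]
      · simp only [Set.indicator_of_notMem hz, add_zero]
        exact not_lt.1 hz
    rw [integral_add (integrable_const _) ((integrable_const _).indicator hSm),
      integral_indicator_const _ hSm] at this
    simp only [integral_const, probReal_univ, smul_eq_mul, one_mul, mul_one] at this
    linarith
  have hE2 : ∫ x, |F x - p| ∂M ≤ t / 4 := by
    rw [integral_prod _ hdi] at hE
    have hpi : Integrable (fun x => |F x - p|) M := (hFi.sub (integrable_const p)).abs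
    have : ∫ x, |F x - p| ∂M ≤ ∫ x, (∫ y, |F x - F y| ∂M + t / 8) ∂M := by
      refine integral_mono hpi (hdi.integral_prod_left.add (integrable_const _)) fun x => ?_
      have e1 : ∫ y, (F x - F y) ∂M = F x - ∫ y, F y ∂M := by
        rw [integral_sub (integrable_const _) hFi]; simp
      have e2 := abs_integral_le_integral_abs (μ := M) (f := fun y => F x - F y)
      rw [e1] at e2
      calc |F x - p| = |(F x - ∫ y, F y ∂M) + (∫ y, F y ∂M - p)| := by congr 1; ring
        _ ≤ _ := (abs_add_le _ _).trans (add_le_add e2 h2)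
    rw [integral_add hdi.integral_prod_left (integrable_const _)] at this
    simp only [integral_const, probReal_univ, smul_eq_mul, one_mul] at this
    linarith
  have hAm : ∀ r : ℝ, MeasurableSet {z | r < |F z - p|} := fun r =>
    measurableSet_lt measurable_const (hF.sub_const p).abs
  -- Markov's inequality: `t / 2` exceeds a median of `|F - p|`, whose mean is at most `t / 4`.
  have hmk : M.real {z | t / 2 < |F z - p|} ≤ 1 / 2 := by
    have := mul_meas_ge_le_integral_of_nonneg (μ := M) (f := fun x => |F x - p|)
      (Eventually.of_forall fun x => abs_nonneg _) ((hFi.sub (integrable_const p)).abs) (t / 2)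
    have h3 : M.real {z | t / 2 < |F z - p|} ≤ M.real {z | t / 2 ≤ |F z - p|} :=
      measureReal_mono fun z hz => le_of_lt (show t / 2 < |F z - p| from hz)
    have h4 := this.trans hE2
    have h5 : t / 2 * M.real {z | t / 2 < |F z - p|} ≤ t / 2 * (1 / 2) :=
      (mul_le_mul_of_nonneg_left h3 (by positivity)).trans (h4.trans (by linarith))
    exact le_of_mul_le_mul_left h5 (by positivity)
  have hcomp : 1 / 2 ≤ M.real {z | t / 2 < |F z - p|}ᶜ := by
    rw [probReal_compl_eq_one_sub (hAm _)]; linarith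
  -- If one copy is further than `t` from `p` and the other within `t / 2`, the copies differ by
  -- more than `t / 2`. By independence, the second event costs only a factor `2`.
  have hprod : M.real {z | t < |F z - p|} * M.real {z | t / 2 < |F z - p|}ᶜ
      ≤ (M.prod M).real {z : W × W | t / 2 < |F z.1 - F z.2|} := by
    rw [← measureReal_prod_prod]
    refine measureReal_mono ?_
    rintro ⟨x, y⟩ ⟨hx, hy⟩
    simp only [Set.mem_ofPred_eq, Set.mem_compl_iff, not_lt] at hx hy ⊢
    have := abs_sub_abs_le_abs_sub (F x - p) (F y - p)
    rw [show F x - p - (F y - p) = F x - F y by ring] at this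
    linarith
  nlinarith [measureReal_nonneg (μ := M) (s := {z | t < |F z - p|})]

/-! ### Combinatorics of the nearest neighbour graph. -/

section Combinatorics

variable {H : Type*} [MetricSpace H] {n : ℕ} {x x' : ℕ → H} {i j : ℕ}

lemma exists_isNearest (hn : 2 ≤ n) (x : ℕ → H) (i : ℕ) : ∃ j, IsNearest n x i j := by
  have hne : ((Finset.range n).erase i).Nonempty := by
    refine Finset.card_pos.1 ?_
    have := Finset.pred_card_le_card_erase (s := Finset.range n) (a := i)
    rw [Finset.card_range] at this
    lia
  obtain ⟨j, hj, hmin⟩ := Finset.exists_min_image _ (fun m => dist (x i) (x m)) hne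
  rw [Finset.mem_erase, Finset.mem_range] at hj
  exact ⟨j, hj.2, hj.1, fun m hm hmi => hmin m (by simp [hm, hmi])⟩

lemma isNearest_nn (hn : 2 ≤ n) (x : ℕ → H) (i : ℕ) : IsNearest n x i (nn n x i) :=
  Nat.sInf_mem (s := {j | IsNearest n x i j}) (exists_isNearest hn x i)

lemma nn_lt (hn : 2 ≤ n) (x : ℕ → H) (i : ℕ) : nn n x i < n := (isNearest_nn hn x i).1

lemma nn_ne (hn : 2 ≤ n) (x : ℕ → H) (i : ℕ) : nn n x i ≠ i := (isNearest_nn hn x i).2.1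

lemma nn_le (h : IsNearest n x i j) : nn n x i ≤ j :=
  Nat.sInf_le (s := {j | IsNearest n x i j}) h

lemma nn_eq_iff (hn : 2 ≤ n) :
    nn n x i = j ↔ IsNearest n x i j ∧ ∀ m < j, ¬ IsNearest n x i m := by
  constructor
  · rintro rfl
    exact ⟨isNearest_nn hn x i, fun m hm h => absurd (nn_le h) (by lia)⟩
  · rintro ⟨h1, h2⟩
    refine le_antisymm (nn_le h1) (not_lt.1 fun h => h2 _ h (isNearest_nn hn x i))

lemma isNearest_congr (h : ∀ m < n, x m = x' m) (hi : i < n) :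
    IsNearest n x i j ↔ IsNearest n x' i j := by
  unfold IsNearest
  refine and_congr_right fun hj => and_congr_right fun _ => ?_
  refine forall_congr' fun m => forall_congr' fun hm => ?_
  rw [h i hi, h j hj, h m hm]

lemma nn_congr (h : ∀ m < n, x m = x' m) (hi : i < n) : nn n x i = nn n x' i := by
  unfold nn
  simp_rw [isNearest_congr h hi]

lemma maxInDegree_congr (h : ∀ m < n, x m = x' m) : maxInDegree n x = maxInDegree n x' := by
  unfold maxInDegree inDegree
  refine Finset.sup_congr rfl fun i _ => ?_
  congr 1
  refine Finset.filter_congr fun j hj => ?_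
  rw [nn_congr h (Finset.mem_range.1 hj)]

lemma pHat_congr {y y' : ℕ → ℕ} (h : ∀ m < n, x m = x' m) (hy : ∀ m < n, y m = y' m)
    (hn : 2 ≤ n) (k l : ℕ) : pHat n x y k l = pHat n x' y' k l := by
  unfold pHat
  congr 1
  refine Finset.sum_congr rfl fun i hi => ?_
  have hi := Finset.mem_range.1 hi
  rw [nn_congr h hi, hy i hi, hy _ (nn_lt hn x' i)]

/-- If two samples agree off `D`, the nearest neighbour of a point off `D` is the same unless one of
the two neighbours is in `D`. -/
lemma nn_le_of_agree_off (hn : 2 ≤ n) (D : Finset ℕ) (h : ∀ m < n, m ∉ D → x m = x' m)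
    (hi : i < n) (hiD : i ∉ D) (h1 : nn n x i ∉ D) (h2 : nn n x' i ∉ D) :
    nn n x i ≤ nn n x' i := by
  -- The points `i`, `nn n x i` and `nn n x' i` are common to both samples, so the neighbour in `x'`
  -- is also a nearest one in `x`. Ties are harmless because `nn` takes the least index.
  refine nn_le ⟨nn_lt hn x' i, nn_ne hn x' i, fun m hm hmi => ?_⟩
  refine le_trans ?_ ((isNearest_nn hn x i).2.2 m hm hmi)
  rw [h i hi hiD, h _ (nn_lt hn x' i) h2, h _ (nn_lt hn x i) h1]
  exact (isNearest_nn hn x' i).2.2 _ (nn_lt hn x i) (nn_ne hn x i)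

lemma nn_eq_of_agree_off (hn : 2 ≤ n) (D : Finset ℕ) (h : ∀ m < n, m ∉ D → x m = x' m)
    (hi : i < n) (hiD : i ∉ D) (h1 : nn n x i ∉ D) (h2 : nn n x' i ∉ D) :
    nn n x i = nn n x' i :=
  le_antisymm (nn_le_of_agree_off hn D h hi hiD h1 h2)
    (nn_le_of_agree_off hn D (fun m hm hD => (h m hm hD).symm) hi hiD h2 h1)

lemma inDegree_le_maxInDegree (hi : i < n) : inDegree n x i ≤ maxInDegree n x :=
  Finset.le_sup (f := inDegree n x) (Finset.mem_range.2 hi)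

lemma card_filter_nn_mem_le (D : Finset ℕ) (hD : D ⊆ Finset.range n) :
    ((Finset.range n).filter fun i => nn n x i ∈ D).card ≤ D.card * maxInDegree n x := by
  have : ((Finset.range n).filter fun i => nn n x i ∈ D) ⊆
      D.biUnion fun d => (Finset.range n).filter fun j => nn n x j = d := by
    intro i hi
    rw [Finset.mem_filter] at hi
    simp only [Finset.mem_biUnion, Finset.mem_filter]
    exact ⟨_, hi.2, hi.1, rfl⟩
  refine (Finset.card_le_card this).trans (Finset.card_biUnion_le_card_mul _ _ _ fun d hd => ?_)
  exact inDegree_le_maxInDegree (Finset.mem_range.1 (hD hd))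

/-- `p̂` has bounded differences in terms of the maximal in-degree. -/
lemma abs_pHat_sub_le {y y' : ℕ → ℕ} (hn : 2 ≤ n) (D : Finset ℕ) (hD : D ⊆ Finset.range n)
    (h : ∀ m < n, m ∉ D → x m = x' m) (hy : ∀ m < n, m ∉ D → y m = y' m) {κ : ℝ}
    (h1 : (maxInDegree n x : ℝ) ≤ κ) (h2 : (maxInDegree n x' : ℝ) ≤ κ) (k l : ℕ) :
    |pHat n x y k l - pHat n x' y' k l| ≤ (1 + 2 * κ) / n * D.card := by
  have hn0 : (0 : ℝ) < n := by exact_mod_cast (by lia : 0 < n)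
  unfold pHat
  rw [← mul_sub, ← Finset.sum_sub_distrib, abs_mul, abs_of_pos (by positivity : (0 : ℝ) < 1 / n)]
  -- The only summands that can change: those indexed by `D`, and those whose neighbour in one of
  -- the two graphs lies in `D`.
  set C : Finset ℕ := D ∪ (((Finset.range n).filter fun i => nn n x i ∈ D) ∪
    ((Finset.range n).filter fun i => nn n x' i ∈ D)) with hC
  have hcard : (C.card : ℝ) ≤ (1 + 2 * κ) * D.card := by
    have a1 := card_filter_nn_mem_le (x := x) D hD
    have a2 := card_filter_nn_mem_le (x := x') D hD
    have a3 : C.card ≤ D.card + (D.card * maxInDegree n x + D.card * maxInDegree n x') :=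
      (Finset.card_union_le _ _).trans (add_le_add le_rfl
        ((Finset.card_union_le _ _).trans (add_le_add a1 a2)))
    have a4 : (C.card : ℝ) ≤ D.card + (D.card * maxInDegree n x + D.card * maxInDegree n x') := by
      exact_mod_cast a3
    have a5 : (0 : ℝ) ≤ D.card := by positivity
    nlinarith [mul_le_mul_of_nonneg_left h1 a5, mul_le_mul_of_nonneg_left h2 a5]
  have hsum : |∑ i ∈ Finset.range n, ((if y i = k ∧ y (nn n x i) = l then (1 : ℝ) else 0)
      - if y' i = k ∧ y' (nn n x' i) = l then (1 : ℝ) else 0)| ≤ C.card := by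
    refine (Finset.abs_sum_le_sum_abs _ _).trans ?_
    calc _ ≤ ∑ i ∈ Finset.range n, (if i ∈ C then (1 : ℝ) else 0) := by
          refine Finset.sum_le_sum fun i hi => ?_
          by_cases hiC : i ∈ C
          · rw [if_pos hiC]
            split_ifs <;> simp
          · rw [if_neg hiC]
            have hi' := Finset.mem_range.1 hi
            simp only [hC, Finset.mem_union, Finset.mem_filter, hi, true_and, not_or] at hiC
            have e := nn_eq_of_agree_off hn D h hi' hiC.1 hiC.2.1 hiC.2.2
            rw [← e, hy i hi' hiC.1, hy _ (nn_lt hn x i) hiC.2.1]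
            simp
      _ ≤ _ := by
          rw [Finset.sum_boole]
          exact_mod_cast Finset.card_le_card fun i hi => (Finset.mem_filter.1 hi).2
  calc _ ≤ 1 / (n : ℝ) * C.card := mul_le_mul_of_nonneg_left hsum (by positivity)
    _ ≤ 1 / (n : ℝ) * ((1 + 2 * κ) * D.card) := mul_le_mul_of_nonneg_left hcard (by positivity)
    _ = _ := by ring

lemma pHat_mem_Icc (n : ℕ) (x : ℕ → H) (y : ℕ → ℕ) (k l : ℕ) :
    pHat n x y k l ∈ Set.Icc (0 : ℝ) 1 := by
  unfold pHat
  rw [Finset.sum_boole]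
  constructor
  · positivity
  · rw [one_div_mul_eq_div]
    refine div_le_one_of_le₀ ?_ (by positivity)
    exact_mod_cast (Finset.card_filter_le _ _).trans (by simp)

/-- Relabelling the sample relabels the nearest neighbours, if these are unique. -/
lemma nn_comp_perm (hn : 2 ≤ n) (σ : Equiv.Perm ℕ) (hσ : ∀ m, σ m < n ↔ m < n)
    (hx : UniqueNearest n x) (hi : i < n) :
    σ (nn n (fun m => x (σ m)) i) = nn n x (σ i) := by
  have key : ∀ a b, IsNearest n (fun m => x (σ m)) a b ↔ IsNearest n x (σ a) (σ b) := by
    intro a b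
    unfold IsNearest
    refine and_congr (hσ b).symm (and_congr (by simp) ?_)
    constructor
    · intro h m hm hma
      have := h (σ.symm m) ((hσ _).1 (by simpa using hm)) (fun e => hma (by simp [← e]))
      simpa using this
    · intro h m hm hma
      exact h (σ m) ((hσ m).2 hm) (by simpa using hma)
  -- Uniqueness is needed here: breaking ties by the least index does not commute with relabelling.
  exact (hx (σ i) ((hσ i).2 hi)).unique ((key _ _).1 (isNearest_nn hn _ i)) (isNearest_nn hn x _)

end Combinatorics

/-! ### Measurability of the graph functionals. -/

section Measurability

variable {α H : Type*} [MeasurableSpace α] [MetricSpace H] [SecondCountableTopology H]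
  [MeasurableSpace H] [BorelSpace H] {X : ℕ → α → H} {Y : ℕ → α → ℕ}

lemma measurable_apply_index {β : Type*} [MeasurableSpace β] {Z : ℕ → α → β}
    (hZ : ∀ i, Measurable (Z i)) {N : α → ℕ} (hN : Measurable N) :
    Measurable fun ω => Z (N ω) ω :=
  (measurable_from_prod_countable_right (f := fun p : ℕ × α => Z p.1 p.2) hZ).comp
    (hN.prodMk measurable_id)

lemma measurableSet_isNearest (hX : ∀ i, Measurable (X i)) (n i j : ℕ) :
    MeasurableSet {ω | IsNearest n (fun m => X m ω) i j} := by
  unfold IsNearest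
  refine (MeasurableSet.const _).inter ((MeasurableSet.const _).inter ?_)
  refine MeasurableSet.congr (s := ⋂ m : ℕ, ⋂ (_ : m < n), ⋂ (_ : m ≠ i),
    {ω | dist (X i ω) (X j ω) ≤ dist (X i ω) (X m ω)}) ?_ (by ext; simp; rfl)
  exact MeasurableSet.iInter fun m => MeasurableSet.iInter fun _ => MeasurableSet.iInter fun _ =>
    measurableSet_le ((hX i).dist (hX j)) ((hX i).dist (hX m))

lemma measurable_nn (hX : ∀ i, Measurable (X i)) {n : ℕ} (hn : 2 ≤ n) (i : ℕ) :
    Measurable fun ω => nn n (fun m => X m ω) i := by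
  refine measurable_to_countable' fun j => ?_
  refine MeasurableSet.congr (s := {ω | IsNearest n (fun m => X m ω) i j} ∩
    ⋂ m : ℕ, ⋂ (_ : m < j), {ω | IsNearest n (fun m => X m ω) i m}ᶜ) ?_ ?_
  · exact (measurableSet_isNearest hX n i j).inter (MeasurableSet.iInter fun m =>
      MeasurableSet.iInter fun _ => (measurableSet_isNearest hX n i m).compl)
  · ext ω
    simp [nn_eq_iff hn]

lemma measurable_maxInDegree (hX : ∀ i, Measurable (X i)) {n : ℕ} (hn : 2 ≤ n) :
    Measurable fun ω => maxInDegree n (fun m => X m ω) := by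
  unfold maxInDegree
  have hd : ∀ i, Measurable fun ω => inDegree n (fun m => X m ω) i := by
    intro i
    unfold inDegree
    simp_rw [Finset.card_filter]
    exact Finset.measurable_sum _ fun j _ => Measurable.ite
      (measurableSet_eq_fun (measurable_nn hX hn j) measurable_const)
      measurable_const measurable_const
  induction Finset.range n using Finset.induction_on with
  | empty => simp
  | insert a s ha ih =>
    simp_rw [Finset.sup_insert]
    exact (hd a).sup ih

lemma measurable_pHat (hX : ∀ i, Measurable (X i)) (hY : ∀ i, Measurable (Y i)) {n : ℕ}
    (hn : 2 ≤ n) (k l : ℕ) :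
    Measurable fun ω => pHat n (fun m => X m ω) (fun m => Y m ω) k l := by
  unfold pHat
  refine (Finset.measurable_sum _ fun i _ => Measurable.ite ?_ measurable_const
    measurable_const).const_mul _
  exact (measurableSet_eq_fun (hY i) measurable_const).inter
    (measurableSet_eq_fun (measurable_apply_index hY (measurable_nn hX hn i)) measurable_const)

end Measurability

/-- Extension of a finite sequence to an infinite one. -/
def padSeq {E : Type*} {n : ℕ} (hn : 2 ≤ n) (z : Fin n → E) (i : ℕ) : E :=
  if h : i < n then z ⟨i, h⟩ else z ⟨0, by lia⟩

lemma padSeq_of_lt {E : Type*} {n : ℕ} (hn : 2 ≤ n) (z : Fin n → E) {i : ℕ} (h : i < n) :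
    padSeq hn z i = z ⟨i, h⟩ := dif_pos h

lemma measurable_padSeq {E : Type*} [MeasurableSpace E] {n : ℕ} (hn : 2 ≤ n) (i : ℕ) :
    Measurable fun z : Fin n → E => padSeq hn z i := by
  by_cases h : i < n
  · simpa [padSeq, h] using measurable_pi_apply (X := fun _ : Fin n => E) ⟨i, h⟩
  · simpa [padSeq, h] using measurable_pi_apply (X := fun _ : Fin n => E) ⟨0, by lia⟩

/-! ### Almost sure concentration of the cell frequencies. -/

section Concentration

variable {Ω H : Type*} [MeasurableSpace Ω] [MetricSpace H] [SecondCountableTopology H]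
  [MeasurableSpace H] [BorelSpace H] {P : Measure Ω} [IsProbabilityMeasure P]
  {Xs : ℕ → Ω → H} {Ys : ℕ → Ω → ℕ}

lemma measurePreserving_fin_sample {P : Measure Ω} {E : Type*} [MeasurableSpace E] {Z : ℕ → Ω → E}
    (hZ : ∀ i, Measurable (Z i)) (hindep : iIndepFun Z P) {ν : Measure E}
    (hν : ∀ i, P.map (Z i) = ν) (n : ℕ) :
    MeasurePreserving (fun ω (i : Fin n) => Z i ω) P (Measure.pi fun _ => ν) := by
  refine ⟨measurable_pi_lambda _ fun i => hZ i, ?_⟩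
  have hp : iIndepFun (fun i : Fin n => Z i) P := hindep.precomp Fin.val_injective
  have := hp.map_fun_eq_pi_map fun i : Fin n => (hZ i).aemeasurable
  simpa [hν] using this

/-- Deviation bound for `p̂` at sample size `n`. -/
lemma measure_pHat_dev_le (hXs : ∀ i, Measurable (Xs i)) (hYs : ∀ i, Measurable (Ys i))
    (hindep : iIndepFun (fun i ω => (Xs i ω, Ys i ω)) P) {ν : Measure (H × ℕ)}
    (hν : ∀ i, P.map (fun ω => (Xs i ω, Ys i ω)) = ν) {n : ℕ} (hn : 2 ≤ n) (κ : ℝ) (a b : ℕ)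
    {p t : ℝ} (ht : 0 < t) :
    let r : ℝ → ℝ := fun s => 2 * P.real {ω | κ ≤ (maxInDegree n (fun i => Xs i ω) : ℝ)}
        + 2 * Real.exp (-(s ^ 2 * n / (2 * (1 + 2 * |κ|) ^ 2)))
    r (t / 16) ≤ t / 16 →
    |∫ ω, pHat n (fun i => Xs i ω) (fun i => Ys i ω) a b ∂P - p| ≤ t / 8 →
    P.real {ω | t < |pHat n (fun i => Xs i ω) (fun i => Ys i ω) a b - p|} ≤ 2 * r (t / 2) := by
  intro r h1 h2
  have hn0 : (0 : ℝ) < n := by exact_mod_cast (by lia : 0 < n)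
  have : Nonempty (Fin n) := ⟨⟨0, by lia⟩⟩
  have hW := measurePreserving_fin_sample (fun i => (hXs i).prodMk (hYs i)) hindep hν n
  have : IsProbabilityMeasure ν := by
    rw [← hν 0]
    exact Measure.isProbabilityMeasure_map ((hXs 0).prodMk (hYs 0)).aemeasurable
  set W : Ω → Fin n → H × ℕ := fun ω i => (Xs i ω, Ys i ω) with hWdef
  set M : Measure (Fin n → H × ℕ) := Measure.pi fun _ => ν with hM
  have hpx : ∀ i, Measurable fun z : Fin n → H × ℕ => (padSeq hn z i).1 := fun i =>
    (measurable_padSeq hn i).fst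
  have hpy : ∀ i, Measurable fun z : Fin n → H × ℕ => (padSeq hn z i).2 := fun i =>
    (measurable_padSeq hn i).snd
  set F : (Fin n → H × ℕ) → ℝ := fun z =>
    pHat n (fun i => (padSeq hn z i).1) (fun i => (padSeq hn z i).2) a b with hFdef
  have hF : Measurable F := measurable_pHat hpx hpy hn a b
  set L : (Fin n → H × ℕ) → ℕ := fun z => maxInDegree n (fun i => (padSeq hn z i).1) with hLdef
  have hL : Measurable L := measurable_maxInDegree hpx hn
  set B : Set (Fin n → H × ℕ) := {z | κ ≤ (L z : ℝ)} with hBdef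
  have hB : MeasurableSet B :=
    measurableSet_le measurable_const ((measurable_of_countable _).comp hL)
  have hFW : ∀ ω, F (W ω) = pHat n (fun i => Xs i ω) (fun i => Ys i ω) a b := by
    intro ω
    refine pHat_congr ?_ ?_ hn a b <;>
    · intro m hm
      simp [padSeq_of_lt hn _ hm, hWdef]
  have hLW : ∀ ω, L (W ω) = maxInDegree n (fun i => Xs i ω) := by
    intro ω
    refine maxInDegree_congr ?_
    intro m hm
    simp [padSeq_of_lt hn _ hm, hWdef]
  have hMB : M.real B = P.real {ω | κ ≤ (maxInDegree n (fun i => Xs i ω) : ℝ)} := by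
    rw [measureReal_def, ← hW.measure_preimage hB.nullMeasurableSet, measureReal_def]
    congr 2
    ext ω
    change κ ≤ (L (W ω) : ℝ) ↔ _
    rw [hLW]; rfl
  have hcopy : ∀ s : ℝ, 0 < s → (M.prod M).real
      {z : (Fin n → H × ℕ) × (Fin n → H × ℕ) | s < |F z.1 - F z.2|} ≤ r s := by
    intro s hs
    -- The absolute value keeps the Lipschitz constant positive even if `κ` is negative.
    have hc : 0 < (1 + 2 * |κ|) / (n : ℝ) := by positivity
    refine (measure_copy_le ν F hF B hB hc hs ?_).trans_eq ?_
    · intro z hz z' hz' D hD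
      have hle : ∀ z ∉ B, (L z : ℝ) ≤ |κ| := fun z hz =>
        (not_le.1 (show ¬ κ ≤ (L z : ℝ) from hz)).le.trans (le_abs_self κ)
      have hagree : ∀ m < n, m ∉ D.map Fin.valEmbedding → padSeq hn z m = padSeq hn z' m := by
        intro m hm hmD
        rw [padSeq_of_lt hn _ hm, padSeq_of_lt hn _ hm]
        refine hD _ fun hmem => hmD ?_
        exact Finset.mem_map.2 ⟨_, hmem, rfl⟩
      have := abs_pHat_sub_le (x := fun i => (padSeq hn z i).1)
        (x' := fun i => (padSeq hn z' i).1) (y := fun i => (padSeq hn z i).2)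
        (y' := fun i => (padSeq hn z' i).2) hn (D.map Fin.valEmbedding) (by
          intro m hm
          obtain ⟨i, _, rfl⟩ := Finset.mem_map.1 hm
          exact Finset.mem_range.2 i.2)
        (fun m hm hmD => by rw [hagree m hm hmD]) (fun m hm hmD => by rw [hagree m hm hmD])
        (hle z hz) (hle z' hz') a b
      rwa [Finset.card_map] at this
    · rw [hMB, Fintype.card_fin]
      simp only [r]
      congr 4
      field_simp
  have hdev := measure_dev_le M F hF (fun z => pHat_mem_Icc _ _ _ _ _) (p := p) ht
    ((hcopy _ (by positivity)).trans h1) (by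
      rw [← hW.map_eq, integral_map hW.measurable.aemeasurable hF.aestronglyMeasurable]
      simpa only [hFW] using h2)
  have hPM : P.real {ω | t < |pHat n (fun i => Xs i ω) (fun i => Ys i ω) a b - p|}
      = M.real {z | t < |F z - p|} := by
    rw [measureReal_def, measureReal_def, ← hW.measure_preimage
      (measurableSet_lt measurable_const (hF.sub_const p).abs).nullMeasurableSet]
    congr 2
    ext ω
    change _ ↔ t < |F (W ω) - p|
    rw [hFW]; rfl
  rw [hPM]
  exact hdev.trans (mul_le_mul_of_nonneg_left (hcopy _ (by positivity)) (by norm_num))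

lemma tendsto_sqrt_div_log :
    Tendsto (fun n : ℕ => Real.sqrt ((n : ℝ) / Real.log n)) atTop atTop := by
  refine Real.tendsto_sqrt_atTop.comp ?_
  have h1 : Tendsto (fun x : ℝ => Real.log x / x) atTop (𝓝[>] 0) := by
    rw [tendsto_nhdsWithin_iff]
    refine ⟨Real.isLittleO_log_id_atTop.tendsto_div_nhds_zero, ?_⟩
    filter_upwards [eventually_gt_atTop (1 : ℝ)] with x hx
    exact div_pos (Real.log_pos hx) (by linarith)
  have h2 := (tendsto_inv_nhdsGT_zero.comp h1).comp (tendsto_natCast_atTop_atTop (R := ℝ))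
  refine h2.congr fun n => ?_
  simp

/-- The rate of `k` makes the exponent eventually at least `2 * log n`, so the terms are dominated
by `n⁻²`. -/
lemma summable_exp_neg {k : ℕ → ℝ}
    (hk_rate : k =o[atTop] fun n : ℕ => Real.sqrt ((n : ℝ) / Real.log (n : ℝ)))
    {s : ℝ} (hs : 0 < s) :
    Summable fun n : ℕ => Real.exp (-(s ^ 2 * n / (2 * (1 + 2 * |k n|) ^ 2))) := by
  have h1 : (fun _ : ℕ => (1 : ℝ)) =o[atTop] fun n : ℕ => Real.sqrt ((n : ℝ) / Real.log n) := by
    rw [isLittleO_const_left]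
    exact Or.inr (tendsto_norm_atTop_atTop.comp tendsto_sqrt_div_log)
  have h2 : (fun n => 1 + 2 * |k n|) =o[atTop]
      fun n : ℕ => Real.sqrt ((n : ℝ) / Real.log n) := h1.add (hk_rate.abs_left.const_mul_left 2)
  -- The factor `s / 2` cancels the `4` arising from `2 * log n` times the denominator's factor `2`.
  have h3 := h2.bound (show (0 : ℝ) < s / 2 by positivity)
  refine Summable.of_norm_bounded_eventually_nat
    (g := fun n : ℕ => ((n : ℝ) ^ 2)⁻¹) (Real.summable_nat_pow_inv.2 (by norm_num)) ?_
  filter_upwards [h3, eventually_ge_atTop 2] with n hn hn2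
  have hn1 : (1 : ℝ) < n := by exact_mod_cast (by lia : 1 < n)
  have hlog := Real.log_pos hn1
  rw [Real.norm_of_nonneg (Real.exp_pos _).le]
  rw [Real.norm_of_nonneg (by positivity), Real.norm_of_nonneg (Real.sqrt_nonneg _)] at hn
  have hsq : (1 + 2 * |k n|) ^ 2 ≤ (s / 2) ^ 2 * (n / Real.log n) := by
    calc _ ≤ (s / 2 * Real.sqrt ((n : ℝ) / Real.log n)) ^ 2 :=
          pow_le_pow_left₀ (by positivity) hn 2
      _ = _ := by rw [mul_pow, Real.sq_sqrt (by positivity)]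
  have hexp : 2 * Real.log n ≤ s ^ 2 * n / (2 * (1 + 2 * |k n|) ^ 2) := by
    rw [le_div_iff₀ (by positivity)]
    calc 2 * Real.log n * (2 * (1 + 2 * |k n|) ^ 2)
        = 4 * Real.log n * (1 + 2 * |k n|) ^ 2 := by ring
      _ ≤ 4 * Real.log n * ((s / 2) ^ 2 * (n / Real.log n)) :=
          mul_le_mul_of_nonneg_left hsq (by positivity)
      _ = s ^ 2 * n := by field_simp; ring
  calc Real.exp (-(s ^ 2 * n / (2 * (1 + 2 * |k n|) ^ 2)))
      ≤ Real.exp (-(2 * Real.log n)) := Real.exp_le_exp.2 (by linarith)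
    _ = _ := by
      rw [Real.exp_neg, mul_comm, ← Real.rpow_def_of_pos (by linarith)]
      norm_num

/-- `p̂` converges almost surely if its expectation converges. -/
lemma ae_tendsto_pHat (hXs : ∀ i, Measurable (Xs i)) (hYs : ∀ i, Measurable (Ys i))
    (hindep : iIndepFun (fun i ω => (Xs i ω, Ys i ω)) P) {ν : Measure (H × ℕ)}
    (hν : ∀ i, P.map (fun ω => (Xs i ω, Ys i ω)) = ν) {k : ℕ → ℝ}
    (hk_sum : Summable fun n : ℕ =>
      P.real {ω | k n ≤ (maxInDegree n (fun i => Xs i ω) : ℝ)})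
    (hk_rate : k =o[atTop] fun n : ℕ => Real.sqrt ((n : ℝ) / Real.log (n : ℝ)))
    (a b : ℕ) {p : ℝ}
    (hmean : Tendsto (fun n => ∫ ω, pHat n (fun i => Xs i ω) (fun i => Ys i ω) a b ∂P)
      atTop (𝓝 p)) :
    ∀ᵐ ω ∂P, Tendsto (fun n => pHat n (fun i => Xs i ω) (fun i => Ys i ω) a b) atTop (𝓝 p) := by
  have hev : ∀ t : ℝ, 0 < t → ∀ᵐ ω ∂P, ∀ᶠ n in atTop,
      |pHat n (fun i => Xs i ω) (fun i => Ys i ω) a b - p| ≤ t := by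
    intro t ht
    have hr : ∀ s : ℝ, 0 < s → Summable fun n : ℕ =>
        2 * P.real {ω | k n ≤ (maxInDegree n (fun i => Xs i ω) : ℝ)}
          + 2 * Real.exp (-(s ^ 2 * n / (2 * (1 + 2 * |k n|) ^ 2))) := fun s hs =>
      (hk_sum.mul_left 2).add ((summable_exp_neg hk_rate hs).mul_left 2)
    have hsum : Summable fun n : ℕ =>
        P.real {ω | t < |pHat n (fun i => Xs i ω) (fun i => Ys i ω) a b - p|} := by
      -- Summable terms tend to `0`, so the smallness condition at `t / 16` in the deviation bound
      -- holds for large `n`.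
      refine Summable.of_norm_bounded_eventually_nat ((hr (t / 2) (by positivity)).mul_left 2) ?_
      filter_upwards [eventually_ge_atTop 2,
        (hr (t / 16) (by positivity)).tendsto_atTop_zero.eventually
          (eventually_le_nhds (show (0 : ℝ) < t / 16 by positivity)),
        (tendsto_iff_dist_tendsto_zero.1 hmean).eventually
          (eventually_le_nhds (show (0 : ℝ) < t / 8 by positivity))] with n hn h1 h2
      rw [Real.norm_of_nonneg measureReal_nonneg]
      exact measure_pHat_dev_le hXs hYs hindep hν hn (k n) a b ht h1 h2
    have hfin : ∑' n, P {ω | t < |pHat n (fun i => Xs i ω) (fun i => Ys i ω) a b - p|} ≠ ⊤ := by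
      have := hsum.tsum_ofReal_ne_top
      simpa [measureReal_def] using this
    filter_upwards [ae_eventually_notMem hfin] with ω hω
    filter_upwards [hω] with n hn
    exact not_lt.1 hn
  have hall : ∀ᵐ ω ∂P, ∀ m : ℕ, ∀ᶠ n in atTop,
      |pHat n (fun i => Xs i ω) (fun i => Ys i ω) a b - p| ≤ 1 / ((m : ℝ) + 1) :=
    ae_all_iff.2 fun m => hev _ (by positivity)
  filter_upwards [hall] with ω hω
  rw [Metric.tendsto_nhds]
  intro ε hε
  obtain ⟨m, hm⟩ := exists_nat_one_div_lt hε
  filter_upwards [hω m] with n hn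
  exact hn.trans_lt hm

end Concentration

/-! ### Conditioning a level on its point. -/

/-- `q` is a version of the conditional probability of the level `b` of the second coordinate
given the first one, under `ν`. -/
def IsLevelDensity {H : Type*} [MeasurableSpace H] (ν : Measure (H × ℕ)) (b : ℕ)
    (q : H → ENNReal) : Prop :=
  Measurable q ∧ ∀ g : H → ENNReal, Measurable g →
    ∫⁻ z, g z.1 * (if z.2 = b then 1 else 0) ∂ν = ∫⁻ z, g z.1 * q z.1 ∂ν

section Level

variable {Ω H : Type*} [MeasurableSpace Ω] [MeasurableSpace H] {P : Measure Ω}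
  [IsProbabilityMeasure P] {Xs : ℕ → Ω → H} {Ys : ℕ → Ω → ℕ}

/-- In the integral of a function of the sample which depends on the `j`-th pair only through its
first coordinate, the indicator of a level of `Y_j` may be replaced by its conditional
probability. -/
lemma lintegral_mul_level (hXs : ∀ i, Measurable (Xs i)) (hYs : ∀ i, Measurable (Ys i))
    (hindep : iIndepFun (fun i ω => (Xs i ω, Ys i ω)) P) {ν : Measure (H × ℕ)}
    (hν : ∀ i, P.map (fun ω => (Xs i ω, Ys i ω)) = ν) {b : ℕ} {q : H → ENNReal}
    (hq : IsLevelDensity ν b q) {n j : ℕ} (G : (ℕ → H × ℕ) → ENNReal)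
    (hG : Measurable G) (hdep : ∀ z z' : ℕ → H × ℕ, (∀ i < n, i ≠ j → z i = z' i) →
      (z j).1 = (z' j).1 → G z = G z') :
    ∫⁻ ω, G (fun i => (Xs i ω, Ys i ω)) * (if Ys j ω = b then 1 else 0) ∂P =
      ∫⁻ ω, G (fun i => (Xs i ω, Ys i ω)) * q (Xs j ω) ∂P := by
  have : IsProbabilityMeasure ν := by
    rw [← hν 0]
    exact Measure.isProbabilityMeasure_map ((hXs 0).prodMk (hYs 0)).aemeasurable
  have hZ : ∀ i, Measurable fun ω => (Xs i ω, Ys i ω) := fun i => (hXs i).prodMk (hYs i)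
  set T : Finset ℕ := (Finset.range n).erase j with hT
  set R : Ω → T → H × ℕ := fun ω i => (Xs i ω, Ys i ω) with hR
  have hRm : Measurable R := measurable_pi_lambda _ fun i => hZ i
  have hind : IndepFun (fun ω => (Xs j ω, Ys j ω)) R P := by
    have h0 := hindep.indepFun_finset {j} T (by simp [hT]) hZ
    exact h0.comp (φ := fun r : ({j} : Finset ℕ) → H × ℕ => r ⟨j, by simp⟩) (ψ := id)
      (measurable_pi_apply _) measurable_id
  have hmap := (indepFun_iff_map_prod_eq_prod_map_map (hZ j).aemeasurable hRm.aemeasurable).1 hind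
  rw [hν j] at hmap
  have : IsProbabilityMeasure (P.map R) := Measure.isProbabilityMeasure_map hRm.aemeasurable
  -- Rebuilds a sample from the `j`-th point and the other pairs below `n`. The label `0` at `j` and
  -- the entries from `n` on are placeholders that `G` does not see.
  set ext : H × (T → H × ℕ) → ℕ → H × ℕ := fun p i =>
    if h : i ∈ T then p.2 ⟨i, h⟩ else (p.1, 0) with hext
  have hextm : Measurable ext := by
    refine measurable_pi_lambda _ fun i => ?_
    by_cases h : i ∈ T
    · simp only [hext, h, dif_pos]
      exact (measurable_pi_apply _).comp measurable_snd
    · simp only [hext, h, dif_neg, not_false_eq_true]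
      exact measurable_fst.prodMk measurable_const
  have hGext : ∀ ω, G (fun i => (Xs i ω, Ys i ω)) = G (ext (Xs j ω, R ω)) := by
    intro ω
    refine hdep _ _ ?_ ?_
    · intro i hi hij
      have : i ∈ T := by simp [hT, hi, hij]
      simp [hext, this, hR]
    · have : j ∉ T := by simp [hT]
      simp [hext, this]
  simp_rw [hGext]
  have hZR : Measurable fun ω => ((Xs j ω, Ys j ω), R ω) := (hZ j).prodMk hRm
  have hGm : Measurable fun p : (H × ℕ) × (T → H × ℕ) => G (ext (p.1.1, p.2)) :=
    hG.comp (hextm.comp (measurable_fst.fst.prodMk measurable_snd))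
  have hlm : Measurable fun p : (H × ℕ) × (T → H × ℕ) =>
      (if p.1.2 = b then (1 : ENNReal) else 0) :=
    Measurable.ite (measurableSet_eq_fun measurable_fst.snd measurable_const)
      measurable_const measurable_const
  have hqm : Measurable fun p : (H × ℕ) × (T → H × ℕ) => q p.1.1 :=
    hq.1.comp measurable_fst.fst
  have e1 := lintegral_map (μ := P) (hGm.fun_mul hlm) hZR
  have e2 := lintegral_map (μ := P) (hGm.fun_mul hqm) hZR
  rw [← e1, ← e2, hmap, lintegral_prod_symm _ (hGm.fun_mul hlm).aemeasurable,
    lintegral_prod_symm _ (hGm.fun_mul hqm).aemeasurable]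
  refine lintegral_congr fun r => ?_
  exact hq.2 (fun x => G (ext (x, r))) (hG.comp (hextm.comp (measurable_id.prodMk measurable_const)))

end Level

/-! ### The mean of a cell frequency. -/

section Expectation

variable {Ω H : Type*} [MeasurableSpace Ω] [MetricSpace H] [SecondCountableTopology H]
  [MeasurableSpace H] [BorelSpace H] {P : Measure Ω} [IsProbabilityMeasure P]
  {Xs : ℕ → Ω → H} {Ys : ℕ → Ω → ℕ}

/-- The law of an i.i.d. sequence is invariant under relabelling. -/
lemma map_comp_perm_eq {P : Measure Ω} {E : Type*} [MeasurableSpace E] {Z : ℕ → Ω → E}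
    (hZ : ∀ i, Measurable (Z i)) (hindep : iIndepFun Z P) {ν : Measure E}
    (hν : ∀ i, P.map (Z i) = ν) (σ : Equiv.Perm ℕ) :
    P.map (fun ω i => Z (σ i) ω) = P.map (fun ω i => Z i ω) := by
  have h1 := hindep.map_fun_eq_infinitePi_map hZ
  have hp : iIndepFun (fun i => Z (σ i)) P := hindep.precomp σ.injective
  have h2 := hp.map_fun_eq_infinitePi_map fun i => hZ (σ i)
  rw [h1, h2]
  simp only [hν]

/-- Exchangeability: the transposition of `0` and `i` preserves the law of the sequence and, nearest
neighbours being almost surely unique, carries the graph along. -/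
lemma measure_level_nn_eq {P : Measure Ω} (hXs : ∀ i, Measurable (Xs i))
    (hYs : ∀ i, Measurable (Ys i))
    (hindep : iIndepFun (fun i ω => (Xs i ω, Ys i ω)) P) {ν : Measure (H × ℕ)}
    (hν : ∀ i, P.map (fun ω => (Xs i ω, Ys i ω)) = ν) {n : ℕ} (hn : 2 ≤ n)
    (huniq : ∀ᵐ ω ∂P, UniqueNearest n (fun i => Xs i ω)) (a b : ℕ) {i : ℕ} (hi : i < n) :
    P {ω | Ys i ω = a ∧ Ys (nn n (fun m => Xs m ω) i) ω = b} =
      P {ω | Ys 0 ω = a ∧ Ys (nn n (fun m => Xs m ω) 0) ω = b} := by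
  set σ : Equiv.Perm ℕ := Equiv.swap 0 i with hσ
  have hσn : ∀ m, σ m < n ↔ m < n := by
    intro m
    rw [hσ, Equiv.swap_apply_def]
    split_ifs with h1 h2 <;> constructor <;> intro <;> lia
  have hZ : ∀ i, Measurable fun ω => (Xs i ω, Ys i ω) := fun i => (hXs i).prodMk (hYs i)
  set S : Set (ℕ → H × ℕ) :=
    {z | (z 0).2 = a ∧ (z (nn n (fun m => (z m).1) 0)).2 = b} with hS
  have hSm : MeasurableSet S := by
    refine (measurableSet_eq_fun (measurable_pi_apply 0).snd measurable_const).inter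
      (measurableSet_eq_fun ?_ measurable_const)
    exact measurable_apply_index (Z := fun i (z : ℕ → H × ℕ) => (z i).2)
      (fun i => (measurable_pi_apply i).snd)
      (measurable_nn (fun i => (measurable_pi_apply i).fst) hn 0)
  have key := congrArg (fun m : Measure (ℕ → H × ℕ) => m S) (map_comp_perm_eq hZ hindep hν σ)
  beta_reduce at key
  rw [Measure.map_apply (measurable_pi_lambda _ fun i => hZ (σ i)) hSm,
    Measure.map_apply (measurable_pi_lambda _ fun i => hZ i) hSm] at key
  refine Eq.trans ?_ key
  refine measure_congr ?_
  filter_upwards [huniq] with ω hω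
  refine propext ?_
  change _ ↔ Ys (σ 0) ω = a ∧ Ys (σ (nn n (fun m => Xs (σ m) ω) 0)) ω = b
  rw [nn_comp_perm hn σ hσn hω (by lia)]
  simp only [hσ, Equiv.swap_apply_left]
  rfl

lemma integral_pHat (hXs : ∀ i, Measurable (Xs i)) (hYs : ∀ i, Measurable (Ys i))
    (hindep : iIndepFun (fun i ω => (Xs i ω, Ys i ω)) P) {ν : Measure (H × ℕ)}
    (hν : ∀ i, P.map (fun ω => (Xs i ω, Ys i ω)) = ν) {n : ℕ} (hn : 2 ≤ n)
    (huniq : ∀ᵐ ω ∂P, UniqueNearest n (fun i => Xs i ω)) (a b : ℕ) :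
    ∫ ω, pHat n (fun i => Xs i ω) (fun i => Ys i ω) a b ∂P =
      P.real {ω | Ys 0 ω = a ∧ Ys (nn n (fun m => Xs m ω) 0) ω = b} := by
  have hn0 : (n : ℝ) ≠ 0 := by exact_mod_cast (by lia : n ≠ 0)
  have hm : ∀ i, MeasurableSet {ω | Ys i ω = a ∧ Ys (nn n (fun m => Xs m ω) i) ω = b} := fun i =>
    (measurableSet_eq_fun (hYs i) measurable_const).inter (measurableSet_eq_fun
      (measurable_apply_index hYs (measurable_nn hXs hn i)) measurable_const)
  have hind : ∀ i, (fun ω => if Ys i ω = a ∧ Ys (nn n (fun m => Xs m ω) i) ω = b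
      then (1 : ℝ) else 0) =
      {ω | Ys i ω = a ∧ Ys (nn n (fun m => Xs m ω) i) ω = b}.indicator fun _ => 1 := by
    intro i; ext ω; simp [Set.indicator_apply]
  unfold pHat
  rw [integral_const_mul, integral_finsetSum]
  · have : ∀ i ∈ Finset.range n, ∫ ω, (if Ys i ω = a ∧ Ys (nn n (fun m => Xs m ω) i) ω = b
      then (1 : ℝ) else 0) ∂P =
        P.real {ω | Ys 0 ω = a ∧ Ys (nn n (fun m => Xs m ω) 0) ω = b} := by
      intro i hi
      rw [hind, integral_indicator_const _ (hm i), smul_eq_mul, mul_one, measureReal_def,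
        measure_level_nn_eq hXs hYs hindep hν hn huniq a b (Finset.mem_range.1 hi),
        measureReal_def]
    rw [Finset.sum_congr rfl this]
    simp only [Finset.sum_const, Finset.card_range, nsmul_eq_mul]
    field_simp
  · intro i _
    rw [hind]
    exact (integrable_const _).indicator (hm i)

/-- On `N(0) = j` the labels `Y 0` and `Y j` belong to two different pairs, and this event involves
only the `X`'s. Conditioning on the points therefore replaces both indicators by conditional
probabilities. -/
lemma measure_level_nn_zero (hXs : ∀ i, Measurable (Xs i)) (hYs : ∀ i, Measurable (Ys i))
    (hindep : iIndepFun (fun i ω => (Xs i ω, Ys i ω)) P) {ν : Measure (H × ℕ)}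
    (hν : ∀ i, P.map (fun ω => (Xs i ω, Ys i ω)) = ν) {a b : ℕ} {q r : H → ENNReal}
    (hq : IsLevelDensity ν a q) (hr : IsLevelDensity ν b r) {n : ℕ} (hn : 2 ≤ n) :
    P {ω | Ys 0 ω = a ∧ Ys (nn n (fun m => Xs m ω) 0) ω = b} =
      ∫⁻ ω, q (Xs 0 ω) * r (Xs (nn n (fun m => Xs m ω) 0) ω) ∂P := by
  have hpx : ∀ i, Measurable fun z : ℕ → H × ℕ => (z i).1 := fun i => (measurable_pi_apply i).fst
  have hpy : ∀ i, Measurable fun z : ℕ → H × ℕ => (z i).2 := fun i => (measurable_pi_apply i).snd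
  have hN0 := measurable_nn hXs hn 0
  have hm : MeasurableSet {ω | Ys 0 ω = a ∧ Ys (nn n (fun m => Xs m ω) 0) ω = b} :=
    (measurableSet_eq_fun (hYs 0) measurable_const).inter (measurableSet_eq_fun
      (measurable_apply_index hYs hN0) measurable_const)
  set N : Ω → ℕ := fun ω => nn n (fun m => Xs m ω) 0 with hN
  set D : ℕ → (ℕ → H × ℕ) → ENNReal := fun j z =>
    if nn n (fun m => (z m).1) 0 = j then 1 else 0 with hD
  have hDm : ∀ j, Measurable (D j) := fun j => Measurable.ite
    (measurableSet_eq_fun (measurable_nn hpx hn 0) measurable_const)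
    measurable_const measurable_const
  have hDdep : ∀ j, ∀ z z' : ℕ → H × ℕ, (∀ i < n, (z i).1 = (z' i).1) → D j z = D j z' := by
    intro j z z' h
    simp only [hD]
    rw [nn_congr h (by lia)]
  -- The two labels are replaced one at a time, first that of `j` and then that of `0`.
  have hstep : ∀ j ∈ (Finset.range n).erase 0,
      ∫⁻ ω, (D j (fun i => (Xs i ω, Ys i ω)) * (if Ys 0 ω = a then 1 else 0)) *
        (if Ys j ω = b then 1 else 0) ∂P =
      ∫⁻ ω, (D j (fun i => (Xs i ω, Ys i ω)) * r (Xs j ω)) * q (Xs 0 ω) ∂P := by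
    intro j hj
    rw [Finset.mem_erase, Finset.mem_range] at hj
    have s1 := lintegral_mul_level hXs hYs hindep hν hr (n := n) (j := j)
      (fun z => D j z * (if (z 0).2 = a then 1 else 0))
      ((hDm j).mul (Measurable.ite (measurableSet_eq_fun (hpy 0) measurable_const)
        measurable_const measurable_const)) (by
        intro z z' h1 h2
        rw [h1 0 (by lia) hj.1.symm, hDdep j z z' fun i hi => ?_]
        by_cases hij : i = j
        · rw [hij, h2]
        · rw [h1 i hi hij])
    have s2 := lintegral_mul_level hXs hYs hindep hν hq (n := n) (j := 0)
      (fun z => D j z * r (z j).1) ((hDm j).mul (hr.1.comp (hpx j))) (by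
        intro z z' h1 h2
        rw [h1 j hj.2 hj.1, hDdep j z z' fun i hi => ?_]
        by_cases hij : i = 0
        · rw [hij, h2]
        · rw [h1 i hi hij])
    beta_reduce at s1 s2
    rw [s1, ← s2]
    refine lintegral_congr fun ω => ?_
    ring
  -- Only the term `j = N(0)` survives; it is in the range because a point is never its own
  -- neighbour.
  have hsel : ∀ ω, ∀ h : ℕ → ENNReal,
      ∑ j ∈ (Finset.range n).erase 0, D j (fun i => (Xs i ω, Ys i ω)) * h j = h (N ω) := by
    intro ω h
    have : N ω ∈ (Finset.range n).erase 0 := by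
      rw [Finset.mem_erase, Finset.mem_range]
      exact ⟨nn_ne hn _ 0, nn_lt hn _ 0⟩
    simp only [hD, ite_mul, one_mul, zero_mul]
    rw [Finset.sum_ite_eq, if_pos this]
  have hDω : ∀ j, Measurable fun ω => D j (fun i => (Xs i ω, Ys i ω)) := fun j =>
    (hDm j).comp (measurable_pi_lambda _ fun i => (hXs i).prodMk (hYs i))
  have hlev : ∀ (c i : ℕ), Measurable fun ω => (if Ys i ω = c then (1 : ENNReal) else 0) :=
    fun c i => Measurable.ite (measurableSet_eq_fun (hYs i) measurable_const)
      measurable_const measurable_const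
  have hrX : ∀ j, Measurable fun ω => r (Xs j ω) := fun j => hr.1.comp (hXs j)
  have hqX : Measurable fun ω => q (Xs 0 ω) := hq.1.comp (hXs 0)
  calc P {ω | Ys 0 ω = a ∧ Ys (N ω) ω = b}
      = ∫⁻ ω, ∑ j ∈ (Finset.range n).erase 0, (D j (fun i => (Xs i ω, Ys i ω)) *
          (if Ys 0 ω = a then 1 else 0)) * (if Ys j ω = b then 1 else 0) ∂P := by
        rw [← lintegral_indicator_one hm]
        refine lintegral_congr fun ω => ?_
        simp_rw [mul_assoc]
        rw [hsel ω fun j => (if Ys 0 ω = a then 1 else 0) * (if Ys j ω = b then 1 else 0)]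
        change Set.indicator {ω | Ys 0 ω = a ∧ Ys (N ω) ω = b} 1 ω = _
        by_cases h1 : Ys 0 ω = a <;> by_cases h2 : Ys (N ω) ω = b <;>
          simp [h1, h2]
    _ = ∫⁻ ω, ∑ j ∈ (Finset.range n).erase 0,
          (D j (fun i => (Xs i ω, Ys i ω)) * r (Xs j ω)) * q (Xs 0 ω) ∂P := by
        rw [lintegral_finsetSum _ fun j _ => ((hDω j).fun_mul (hlev a 0)).fun_mul (hlev b j),
          lintegral_finsetSum _ fun j _ =>
            ((hDω j).fun_mul (hrX j)).fun_mul hqX]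
        exact Finset.sum_congr rfl hstep
    _ = _ := by
        refine lintegral_congr fun ω => ?_
        simp_rw [mul_assoc]
        rw [hsel ω fun j => r (Xs j ω) * q (Xs 0 ω), mul_comm]

end Expectation

/-! ### The quantile representation of the levels. -/

section LevelMap

variable {H : Type*} {K : ℕ} {Q : ℕ → H → ℝ}

instance : IsProbabilityMeasure unif := ⟨by simp [unif]⟩

/-- `Q 1 x, …, Q K x` are the weights of a probability distribution. -/
def IsWeight (K : ℕ) (Q : ℕ → H → ℝ) (x : H) : Prop :=
  (∀ k ∈ Finset.Icc 1 K, 0 ≤ Q k x) ∧ ∑ k ∈ Finset.Icc 1 K, Q k x = 1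

lemma IsWeight.sum_mono {x : H} (h : IsWeight K Q x) {a b : ℕ} (hab : a ≤ b) (hb : b ≤ K) :
    ∑ j ∈ Finset.Icc 1 a, Q j x ≤ ∑ j ∈ Finset.Icc 1 b, Q j x :=
  Finset.sum_le_sum_of_subset_of_nonneg (Finset.Icc_subset_Icc_right hab) fun j hj _ =>
    h.1 j (Finset.Icc_subset_Icc_right hb hj)

lemma IsWeight.mem_Icc {x : H} (h : IsWeight K Q x) {b : ℕ} (hb : b ∈ Finset.Icc 1 K) :
    Q b x ∈ Set.Icc (0 : ℝ) 1 :=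
  ⟨h.1 b hb, h.2 ▸ Finset.single_le_sum (f := fun k => Q k x) h.1 hb⟩

lemma IsWeight.levelMap_eq_iff {x : H} (h : IsWeight K Q x) {b : ℕ} (hb : b ∈ Finset.Icc 1 K)
    {u : ℝ} (hu : 0 ≤ u) :
    levelMap K Q x u = b ↔
      u ∈ Set.Ico (∑ j ∈ Finset.Icc 1 (b - 1), Q j x) (∑ j ∈ Finset.Icc 1 b, Q j x) := by
  have hb' := Finset.mem_Icc.1 hb
  unfold levelMap
  set S : Set ℕ := {k : ℕ | k ∈ Finset.Icc 1 K ∧ u < ∑ j ∈ Finset.Icc 1 k, Q j x} with hS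
  constructor
  · intro e
    -- The default value `sInf ∅ = 0` is excluded by `1 ≤ b`.
    have hne : S.Nonempty := Nat.nonempty_of_pos_sInf (by lia)
    have hmem : b ∈ S := e ▸ Nat.sInf_mem hne
    refine ⟨?_, hmem.2⟩
    by_contra! hlt
    rcases Nat.eq_zero_or_pos (b - 1) with h0 | h0
    · rw [h0] at hlt; simp at hlt; linarith
    · have : sInf S ≤ b - 1 := Nat.sInf_le ⟨Finset.mem_Icc.2 ⟨h0, by lia⟩, hlt⟩
      lia
  · rintro ⟨h1, h2⟩
    have hmem : b ∈ S := ⟨hb, h2⟩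
    refine le_antisymm (Nat.sInf_le hmem) ?_
    by_contra! hlt
    have hm : sInf S ∈ S := Nat.sInf_mem ⟨b, hmem⟩
    have := h.sum_mono (a := sInf S) (b := b - 1) (by lia) (by lia)
    linarith [hm.2]

lemma IsWeight.unif_levelMap {x : H} (h : IsWeight K Q x) {b : ℕ} (hb : b ∈ Finset.Icc 1 K) :
    unif {u | levelMap K Q x u = b} = ENNReal.ofReal (Q b x) := by
  have hb' := Finset.mem_Icc.1 hb
  have hS0 : 0 ≤ ∑ j ∈ Finset.Icc 1 (b - 1), Q j x := by
    simpa using h.sum_mono (a := 0) (b := b - 1) (by lia) (by lia)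
  have hS1 : ∑ j ∈ Finset.Icc 1 b, Q j x ≤ 1 := by
    have := h.sum_mono (a := b) (b := K) hb'.2 le_rfl
    rwa [h.2] at this
  have hsum : ∑ j ∈ Finset.Icc 1 b, Q j x - ∑ j ∈ Finset.Icc 1 (b - 1), Q j x = Q b x := by
    obtain ⟨c, rfl⟩ : ∃ c, b = c + 1 := ⟨b - 1, by lia⟩
    rw [Finset.sum_Icc_succ_top (by lia)]
    simp
  have hset : unif {u | levelMap K Q x u = b} = unif (Set.Ico
      (∑ j ∈ Finset.Icc 1 (b - 1), Q j x) (∑ j ∈ Finset.Icc 1 b, Q j x)) := by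
    refine measure_congr ?_
    have : ∀ᵐ u ∂unif, u ∈ Set.Ioo (0 : ℝ) 1 := ae_restrict_mem measurableSet_Ioo
    filter_upwards [this] with u hu
    exact propext (h.levelMap_eq_iff hb hu.1.le)
  rw [hset, unif, restrict_Ioo_eq_restrict_Ico, Measure.restrict_apply measurableSet_Ico,
    Set.inter_eq_left.2 (Set.Ico_subset_Ico hS0 hS1), Real.volume_Ico, hsum]

/-- The value `0` needs separate care, since it also arises from an empty set of indices. -/
lemma measurable_sInf_nat {α : Type*} [MeasurableSpace α] (A : ℕ → Set α)
    (hA : ∀ k, MeasurableSet (A k)) : Measurable fun p => sInf {k | p ∈ A k} := by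
  refine measurable_to_countable' fun m => ?_
  refine MeasurableSet.congr (s := (A m ∩ ⋂ j : ℕ, ⋂ (_ : j < m), (A j)ᶜ) ∪
    ({p | m = 0} ∩ ⋂ j : ℕ, (A j)ᶜ)) ?_ ?_
  · exact ((hA m).inter (MeasurableSet.iInter fun j => MeasurableSet.iInter fun _ =>
      (hA j).compl)).union ((MeasurableSet.const _).inter
        (MeasurableSet.iInter fun j => (hA j).compl))
  · ext p
    simp only [Set.mem_union, Set.mem_inter_iff, Set.mem_iInter, Set.mem_compl_iff,
      Set.mem_preimage, Set.mem_singleton_iff]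
    change _ ∨ (m = 0 ∧ _) ↔ _
    constructor
    · rintro (⟨h1, h2⟩ | ⟨rfl, h⟩)
      · refine le_antisymm (Nat.sInf_le h1) (not_lt.1 fun hlt => ?_)
        exact h2 _ hlt (Nat.sInf_mem (s := {k | p ∈ A k}) ⟨m, h1⟩)
      · rw [Nat.sInf_eq_zero]
        exact Or.inr (Set.eq_empty_of_forall_notMem h)
    · rintro rfl
      rcases Set.eq_empty_or_nonempty {k | p ∈ A k} with he | hne
      · right
        refine ⟨by rw [he]; simp, fun j hj => ?_⟩
        have : j ∈ {k | p ∈ A k} := hj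
        rw [he] at this
        exact this
      · exact Or.inl ⟨Nat.sInf_mem hne, fun j hj hmem => absurd (Nat.sInf_le
          (s := {k | p ∈ A k}) hmem) (by lia)⟩

lemma measurable_levelMap [MeasurableSpace H] (hQ : ∀ k ∈ Finset.Icc 1 K, Measurable (Q k)) :
    Measurable fun p : H × ℝ => levelMap K Q p.1 p.2 := by
  refine measurable_sInf_nat
    (fun k => {p : H × ℝ | k ∈ Finset.Icc 1 K ∧ p.2 < ∑ j ∈ Finset.Icc 1 k, Q j p.1}) fun k => ?_
  by_cases hk : k ∈ Finset.Icc 1 K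
  · simp only [hk, true_and]
    refine measurableSet_lt measurable_snd (Finset.measurable_sum _ fun j hj => ?_)
    exact (hQ j (Finset.Icc_subset_Icc_right (Finset.mem_Icc.1 hk).2 hj)).comp measurable_fst
  · simp [hk]

end LevelMap

/-! ### Cell and marginal probabilities of the coupling. -/

section Coupling

variable {H : Type*} [MeasurableSpace H] {K : ℕ} {Q : ℕ → H → ℝ} {μ : Measure H}

lemma integrable_weight [IsProbabilityMeasure μ]
    (hQ : ∀ k ∈ Finset.Icc 1 K, Measurable (Q k)) (hw : ∀ᵐ x ∂μ, IsWeight K Q x)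
    {i : ℕ} (hi : i ∈ Finset.Icc 1 K) : Integrable (Q i) μ := by
  refine Integrable.of_bound (hQ i hi).aestronglyMeasurable 1 ?_
  filter_upwards [hw] with x hx
  rw [Real.norm_of_nonneg (hx.mem_Icc hi).1]
  exact (hx.mem_Icc hi).2

lemma integrable_weight_mul [IsProbabilityMeasure μ]
    (hQ : ∀ k ∈ Finset.Icc 1 K, Measurable (Q k)) (hw : ∀ᵐ x ∂μ, IsWeight K Q x)
    {i j : ℕ} (hi : i ∈ Finset.Icc 1 K) (hj : j ∈ Finset.Icc 1 K) : Integrable (fun x => Q i x * Q j x) μ := by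
  refine Integrable.of_bound ((hQ i hi).fun_mul (hQ j hj)).aestronglyMeasurable 1 ?_
  filter_upwards [hw] with x hx
  have h1 := hx.mem_Icc hi
  have h2 := hx.mem_Icc hj
  rw [Real.norm_of_nonneg (mul_nonneg h1.1 h2.1)]
  exact mul_le_one₀ h1.2 h2.1 h2.2

/-- For fixed `x` the event is a product set in `(u, u')`, and its sides have lengths `Q i x` and `Q
j x`. -/
lemma couplingLaw_cell (hQ : ∀ k ∈ Finset.Icc 1 K, Measurable (Q k))
    (hw : ∀ᵐ x ∂μ, IsWeight K Q x)
    {i j : ℕ} (hi : i ∈ Finset.Icc 1 K) (hj : j ∈ Finset.Icc 1 K) :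
    (couplingLaw μ).real {z | levelMap K Q z.1 z.2.1 = i ∧ levelMap K Q z.1 z.2.2 = j} =
      ∫ x, Q i x * Q j x ∂μ := by
  have hm := measurable_levelMap hQ
  have h1 : Measurable fun z : H × ℝ × ℝ => levelMap K Q z.1 z.2.1 :=
    hm.comp (measurable_fst.prodMk measurable_snd.fst)
  have h2 : Measurable fun z : H × ℝ × ℝ => levelMap K Q z.1 z.2.2 :=
    hm.comp (measurable_fst.prodMk measurable_snd.snd)
  have hs : MeasurableSet {z : H × ℝ × ℝ |
      levelMap K Q z.1 z.2.1 = i ∧ levelMap K Q z.1 z.2.2 = j} :=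
    (measurableSet_eq_fun h1 measurable_const).inter (measurableSet_eq_fun h2 measurable_const)
  rw [integral_eq_lintegral_of_nonneg_ae
    (by filter_upwards [hw] with x hx; exact mul_nonneg (hx.1 i hi) (hx.1 j hj))
    ((hQ i hi).fun_mul (hQ j hj)).aestronglyMeasurable, measureReal_def, couplingLaw,
    Measure.prod_apply hs]
  congr 1
  refine lintegral_congr_ae ?_
  filter_upwards [hw] with x hx
  rw [ENNReal.ofReal_mul (hx.1 i hi), ← hx.unif_levelMap hi, ← hx.unif_levelMap hj,
    ← Measure.prod_prod]
  rfl

lemma couplingLaw_fst (hQ : ∀ k ∈ Finset.Icc 1 K, Measurable (Q k))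
    (hw : ∀ᵐ x ∂μ, IsWeight K Q x) {i : ℕ} (hi : i ∈ Finset.Icc 1 K) :
    (couplingLaw μ).real {z | levelMap K Q z.1 z.2.1 = i} = ∫ x, Q i x ∂μ := by
  have h1 : Measurable fun z : H × ℝ × ℝ => levelMap K Q z.1 z.2.1 :=
    (measurable_levelMap hQ).comp (measurable_fst.prodMk measurable_snd.fst)
  rw [integral_eq_lintegral_of_nonneg_ae
    (by filter_upwards [hw] with x hx; exact hx.1 i hi)
    (hQ i hi).aestronglyMeasurable, measureReal_def, couplingLaw,
    Measure.prod_apply (measurableSet_eq_fun h1 measurable_const)]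
  congr 1
  refine lintegral_congr_ae ?_
  filter_upwards [hw] with x hx
  rw [← hx.unif_levelMap hi, ← mul_one (unif _), ← measure_univ (μ := unif), ← Measure.prod_prod]
  congr 1
  ext z
  exact (and_iff_left trivial).symm

lemma couplingLaw_snd (hQ : ∀ k ∈ Finset.Icc 1 K, Measurable (Q k))
    (hw : ∀ᵐ x ∂μ, IsWeight K Q x) {i : ℕ} (hi : i ∈ Finset.Icc 1 K) :
    (couplingLaw μ).real {z | levelMap K Q z.1 z.2.2 = i} = ∫ x, Q i x ∂μ := by
  have h1 : Measurable fun z : H × ℝ × ℝ => levelMap K Q z.1 z.2.2 :=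
    (measurable_levelMap hQ).comp (measurable_fst.prodMk measurable_snd.snd)
  rw [integral_eq_lintegral_of_nonneg_ae
    (by filter_upwards [hw] with x hx; exact hx.1 i hi)
    (hQ i hi).aestronglyMeasurable, measureReal_def, couplingLaw,
    Measure.prod_apply (measurableSet_eq_fun h1 measurable_const)]
  congr 1
  refine lintegral_congr_ae ?_
  filter_upwards [hw] with x hx
  rw [← hx.unif_levelMap hi, ← one_mul (unif _), ← measure_univ (μ := unif), ← Measure.prod_prod]
  congr 1
  ext z
  exact (and_iff_right trivial).symm

end Coupling

/-! ### From conditional expectations to weights and densities. -/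

section CondProb

variable {Ω H : Type*} [MeasurableSpace Ω] [mH : MeasurableSpace H] {P : Measure Ω}
  [IsProbabilityMeasure P] {X : Ω → H} {Y : Ω → ℕ} {K : ℕ} {Q : ℕ → H → ℝ}

/-- The level indicators are nonnegative and sum almost surely to `1`; conditional expectation
preserves both properties. -/
lemma IsCondProb.ae_isWeight (hQ : IsCondProb P X Y K Q) (hX : Measurable X) (hY : Measurable Y)
    (hlev : ∀ᵐ ω ∂P, Y ω ∈ Finset.Icc 1 K) : ∀ᵐ x ∂(P.map X), IsWeight K Q x := by
  have hint : ∀ k, Integrable ({ω | Y ω = k}.indicator fun _ => (1 : ℝ)) P := fun k =>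
    (integrable_const _).indicator (measurableSet_eq_fun hY measurable_const)
  have h0 : ∀ᵐ ω ∂P, ∀ k ∈ Finset.Icc 1 K, 0 ≤ Q k (X ω) := by
    rw [Finset.eventually_all]
    intro k hk
    have := condExp_nonneg (μ := P) (m := MeasurableSpace.comap X mH)
      (f := {ω | Y ω = k}.indicator fun _ => (1 : ℝ))
      (Eventually.of_forall fun ω => Set.indicator_nonneg (fun _ _ => zero_le_one) ω)
    filter_upwards [(hQ k hk).2, this] with ω h1 h2
    rw [h1]; exact h2
  have h1 : ∀ᵐ ω ∂P, ∑ k ∈ Finset.Icc 1 K, Q k (X ω) = 1 := by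
    have hsum : (∑ k ∈ Finset.Icc 1 K, {ω | Y ω = k}.indicator fun _ => (1 : ℝ))
        =ᵐ[P] fun _ => (1 : ℝ) := by
      filter_upwards [hlev] with ω hω
      rw [Finset.sum_apply]
      calc ∑ c ∈ Finset.Icc 1 K, Set.indicator {ω | Y ω = c} (fun _ => (1 : ℝ)) ω
          = ∑ c ∈ Finset.Icc 1 K, if Y ω = c then (1 : ℝ) else 0 :=
            Finset.sum_congr rfl fun c _ => by simp [Set.indicator_apply]
        _ = 1 := by rw [Finset.sum_ite_eq, if_pos hω]
    have e1 := condExp_congr_ae (m := MeasurableSpace.comap X mH) hsum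
    rw [condExp_const hX.comap_le] at e1
    have e2 := condExp_finsetSum (μ := P) (s := Finset.Icc 1 K) (fun k _ => hint k)
      (MeasurableSpace.comap X mH)
    have e3 : ∀ᵐ ω ∂P, ∀ k ∈ Finset.Icc 1 K, Q k (X ω) =
        (P[{ω | Y ω = k}.indicator (fun _ => (1 : ℝ)) | MeasurableSpace.comap X mH]) ω := by
      rw [Finset.eventually_all]
      exact fun k hk => (hQ k hk).2
    filter_upwards [e1, e2, e3] with ω h1 h2 h3
    rw [Finset.sum_congr rfl h3, ← Finset.sum_apply, ← h2, h1]
  have hset : MeasurableSet {x | IsWeight K Q x} := by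
    unfold IsWeight
    refine MeasurableSet.inter ?_ (measurableSet_eq_fun
      (Finset.measurable_sum _ fun k hk => (hQ k hk).1) measurable_const)
    refine MeasurableSet.congr (s := ⋂ k ∈ Finset.Icc 1 K, {x | 0 ≤ Q k x}) ?_ (by ext; simp; rfl)
    exact Finset.measurableSet_biInter _ fun k hk => measurableSet_le measurable_const (hQ k hk).1
  rw [ae_map_iff hX.aemeasurable hset]
  filter_upwards [h0, h1] with ω a b using ⟨a, b⟩

lemma IsCondProb.isLevelDensity (hQ : IsCondProb P X Y K Q) (hX : Measurable X)
    (hY : Measurable Y) (hw : ∀ᵐ x ∂(P.map X), IsWeight K Q x) {b : ℕ}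
    (hb : b ∈ Finset.Icc 1 K) :
    IsLevelDensity (P.map fun ω => (X ω, Y ω)) b fun x => ENNReal.ofReal (Q b x) := by
  have hQm := (hQ b hb).1
  refine ⟨hQm.ennreal_ofReal, fun g hg => ?_⟩
  have hYb : MeasurableSet {ω | Y ω = b} := measurableSet_eq_fun hY measurable_const
  have hwX : ∀ᵐ ω ∂P, IsWeight K Q (X ω) := ae_of_ae_map hX.aemeasurable hw
  -- On sets of the form `X ⁻¹' B` this is the defining property of conditional expectation.
  -- Equality of the image measures then allows every measurable `g` at once.
  have hmeas : (P.restrict {ω | Y ω = b}).map X =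
      (P.withDensity fun ω => ENNReal.ofReal (Q b (X ω))).map X := by
    ext B hB
    rw [Measure.map_apply hX hB, Measure.map_apply hX hB, withDensity_apply _ (hX hB),
      Measure.restrict_apply (hX hB)]
    have hint : Integrable (fun ω => Q b (X ω)) P :=
      Integrable.congr integrable_condExp (hQ b hb).2.symm
    rw [← ofReal_integral_eq_lintegral_ofReal hint.integrableOn
      (ae_restrict_of_ae (by filter_upwards [hwX] with ω hω; exact hω.1 b hb)),
      integral_congr_ae (ae_restrict_of_ae (hQ b hb).2),
      setIntegral_condExp hX.comap_le ((integrable_const _).indicator hYb) ⟨B, hB, rfl⟩,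
      setIntegral_indicator hYb]
    simp
  have hZ : Measurable fun ω => (X ω, Y ω) := hX.prodMk hY
  have hg1 : Measurable fun z : H × ℕ => g z.1 := hg.comp measurable_fst
  have hQ1 : Measurable fun z : H × ℕ => ENNReal.ofReal (Q b z.1) :=
    hQm.ennreal_ofReal.comp measurable_fst
  rw [lintegral_map (hg1.fun_mul (Measurable.ite
      (measurableSet_eq_fun measurable_snd measurable_const) measurable_const measurable_const)) hZ,
    lintegral_map (hg1.fun_mul hQ1) hZ]
  have e1 : ∫⁻ ω, g (X ω) ∂(P.restrict {ω | Y ω = b}) =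
      ∫⁻ ω, g (X ω) ∂(P.withDensity fun ω => ENNReal.ofReal (Q b (X ω))) := by
    rw [← lintegral_map hg hX, hmeas, lintegral_map hg hX]
  have hQX : Measurable fun ω => ENNReal.ofReal (Q b (X ω)) := hQm.ennreal_ofReal.comp hX
  have hgX : Measurable fun ω => g (X ω) := hg.comp hX
  rw [lintegral_withDensity_eq_lintegral_mul _ hQX hgX,
    ← lintegral_indicator hYb] at e1
  refine Eq.trans (lintegral_congr fun ω => ?_) (e1.trans (lintegral_congr fun ω => ?_))
  · simp [Set.indicator_apply]
  · simp [mul_comm]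

end CondProb

/-! ### The weights at the nearest neighbour. -/

section NearestNeighbour

variable {Ω H : Type*} [MeasurableSpace Ω] [MetricSpace H] [SecondCountableTopology H]
  [MeasurableSpace H] [BorelSpace H] {P : Measure Ω} [IsProbabilityMeasure P]
  {Xs : ℕ → Ω → H} {μ : Measure H} {K : ℕ} {Q : ℕ → H → ℝ}

/-- A set of positive probability is visited by the sample after time `0`. -/
lemma ae_exists_mem {H : Type*} [MeasurableSpace H] {Xs : ℕ → Ω → H} {μ : Measure H}
    (hXs : ∀ i, Measurable (Xs i)) (hindep : iIndepFun Xs P)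
    (hμ : ∀ i, P.map (Xs i) = μ) {B : Set H} (hB : MeasurableSet B) (hB0 : μ B ≠ 0) :
    ∀ᵐ ω ∂P, ∃ i, i ≠ 0 ∧ Xs i ω ∈ B := by
  have hm : ∀ i, MeasurableSet (Xs i ⁻¹' B) := fun i => hXs i hB
  have hset : iIndepSet (fun i => Xs i ⁻¹' B) P := by
    rw [iIndepSet_iff_meas_biInter hm]
    exact fun s => hindep.meas_biInter fun i _ => ⟨B, hB, rfl⟩
  have hval : ∀ i, P (Xs i ⁻¹' B) = μ B := fun i => by
    rw [← hμ i, Measure.map_apply (hXs i) hB]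
  -- Second Borel–Cantelli lemma: the visits are independent events of constant positive
  -- probability.
  have h1 := measure_limsup_eq_one hm hset (by
    simp only [hval]
    exact ENNReal.tsum_const_eq_top_of_ne_zero hB0)
  have h2 : ∀ᵐ ω ∂P, ω ∈ limsup (fun i => Xs i ⁻¹' B) atTop :=
    (prob_compl_eq_zero_iff (MeasurableSet.measurableSet_limsup hm)).2 h1
  filter_upwards [h2] with ω hω
  obtain ⟨i, hi, hmem⟩ := (mem_limsup_iff_frequently_mem.1 hω).forall_exists_of_atTop 1
  exact ⟨i, by lia, hmem⟩

/-- The nearest neighbour of the first point converges to that point. -/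
lemma ae_tendsto_nn (hXs : ∀ i, Measurable (Xs i)) (hindep : iIndepFun Xs P)
    (hμ : ∀ i, P.map (Xs i) = μ) :
    ∀ᵐ ω ∂P, Tendsto (fun n => Xs (nn n (fun m => Xs m ω) 0) ω) atTop (𝓝 (Xs 0 ω)) := by
  have h1 : ∀ᵐ ω ∂P, ∀ B ∈ TopologicalSpace.countableBasis H, μ B ≠ 0 →
      ∃ i, i ≠ 0 ∧ Xs i ω ∈ B := by
    rw [ae_ball_iff (TopologicalSpace.countable_countableBasis H)]
    intro B hB
    by_cases h0 : μ B = 0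
    · exact Eventually.of_forall fun ω h => absurd h0 h
    · filter_upwards [ae_exists_mem hXs hindep hμ
        (TopologicalSpace.isOpen_of_mem_countableBasis hB).measurableSet h0] with ω hω _ using hω
  -- By second countability the support carries all the mass, so every basic neighbourhood of `Xs 0
  -- ω` has positive measure and is visited later.
  have h2 : ∀ᵐ ω ∂P, Xs 0 ω ∈ μ.support := by
    refine ae_of_ae_map (hXs 0).aemeasurable ?_
    rw [hμ 0]
    exact Measure.support_mem_ae
  filter_upwards [h1, h2] with ω h1 h2
  rw [Metric.tendsto_atTop]
  intro ε hε
  obtain ⟨B, hB, hmem, hsub⟩ :=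
    (TopologicalSpace.isBasis_countableBasis H).mem_nhds_iff.1 (Metric.ball_mem_nhds (Xs 0 ω) hε)
  have hpos := (Measure.mem_support_iff_forall _).1 h2 B
    ((TopologicalSpace.isOpen_of_mem_countableBasis hB).mem_nhds hmem)
  obtain ⟨i, hi, hiB⟩ := h1 B hB hpos.ne'
  -- This ensures both `2 ≤ n` and `i < n`.
  refine ⟨i + 2, fun n hn => ?_⟩
  rw [dist_comm]
  refine ((isNearest_nn (by lia) (fun m => Xs m ω) 0).2.2 i (by lia) hi).trans_lt ?_
  rw [dist_comm]
  exact hsub hiB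

lemma measurable_weight_nn (hXs : ∀ i, Measurable (Xs i)) {q : H → ℝ} (hq : Measurable q)
    {n : ℕ} (hn : 2 ≤ n) : Measurable fun ω => q (Xs (nn n (fun m => Xs m ω) 0) ω) :=
  hq.comp (measurable_apply_index hXs (measurable_nn hXs hn 0))

lemma tendsto_integral_abs_sub_of_condB (hXs : ∀ i, Measurable (Xs i)) (hindep : iIndepFun Xs P)
    (hμ : ∀ i, P.map (Xs i) = μ) (hQ : ∀ k ∈ Finset.Icc 1 K, Measurable (Q k))
    (hw : ∀ᵐ ω ∂P, ∀ i, IsWeight K Q (Xs i ω)) (hB : CondB μ K Q) {b : ℕ}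
    (hb : b ∈ Finset.Icc 1 K) :
    Tendsto (fun n => ∫ ω, |Q b (Xs (nn n (fun m => Xs m ω) 0) ω) - Q b (Xs 0 ω)| ∂P)
      atTop (𝓝 0) := by
  have h := tendsto_integral_filter_of_dominated_convergence (μ := P) (l := atTop)
    (F := fun (n : ℕ) ω => |Q b (Xs (nn n (fun m => Xs m ω) 0) ω) - Q b (Xs 0 ω)|)
    (f := fun _ => (0 : ℝ)) (fun _ => (1 : ℝ)) ?_ ?_ (integrable_const _) ?_
  · simpa using h
  · filter_upwards [eventually_ge_atTop 2] with n hn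
    exact ((measurable_weight_nn hXs (hQ b hb) hn).sub
      ((hQ b hb).comp (hXs 0))).abs.aestronglyMeasurable
  · refine Eventually.of_forall fun n => ?_
    filter_upwards [hw] with ω hω
    have h1 := (hω (nn n (fun m => Xs m ω) 0)).mem_Icc hb
    have h2 := (hω 0).mem_Icc hb
    rw [Real.norm_eq_abs, abs_abs, abs_le]
    constructor <;> linarith [h1.1, h1.2, h2.1, h2.2]
  · have hcont : ∀ᵐ ω ∂P, ContinuousAt (Q b) (Xs 0 ω) :=
      ae_of_ae_map (hXs 0).aemeasurable (by rw [hμ 0]; exact hB b hb)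
    filter_upwards [hcont, ae_tendsto_nn hXs hindep hμ] with ω h1 h2
    have h3 := ((h1.tendsto.comp h2).sub_const (Q b (Xs 0 ω))).abs
    simpa using h3

/-- By Fubini and dominated convergence, (a) makes the probability that the levels at the point and
at its neighbour disagree for a common uniform `u` tend to `0`. Given the sample, this disagreement
dominates the difference of the weights. -/
lemma tendsto_integral_abs_sub_of_condA (hXs : ∀ i, Measurable (Xs i))
    (hQ : ∀ k ∈ Finset.Icc 1 K, Measurable (Q k))
    (hw : ∀ᵐ ω ∂P, ∀ i, IsWeight K Q (Xs i ω)) (hA : CondA P K Q Xs) {b : ℕ}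
    (hb : b ∈ Finset.Icc 1 K) :
    Tendsto (fun n => ∫ ω, |Q b (Xs (nn n (fun m => Xs m ω) 0) ω) - Q b (Xs 0 ω)| ∂P)
      atTop (𝓝 0) := by
  set S : ℕ → Set (Ω × ℝ) := fun n => {p | levelMap K Q
    (Xs (nn n (fun m => Xs m p.1) 0) p.1) p.2 ≠ levelMap K Q (Xs 0 p.1) p.2} with hS
  have hSm : ∀ n, 2 ≤ n → MeasurableSet (S n) := by
    intro n hn
    have hm := measurable_levelMap hQ
    have hN := measurable_apply_index hXs (measurable_nn hXs hn 0)
    exact (measurableSet_eq_fun (hm.comp ((hN.comp measurable_fst).prodMk measurable_snd))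
      (hm.comp (((hXs 0).comp measurable_fst).prodMk measurable_snd))).compl
  have hlim : Tendsto (fun n => (P.prod unif) (S n)) atTop (𝓝 0) := by
    have h := tendsto_lintegral_filter_of_dominated_convergence (μ := unif) (l := atTop)
      (F := fun (n : ℕ) u => P ((fun ω => (ω, u)) ⁻¹' S n)) (f := fun _ => 0) (fun _ => 1)
      ?_ ?_ (by simp) ?_
    · rw [lintegral_zero] at h
      refine h.congr' ?_
      filter_upwards [eventually_ge_atTop 2] with n hn
      rw [Measure.prod_apply_symm (hSm n hn)]
    · filter_upwards [eventually_ge_atTop 2] with n hn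
      exact measurable_measure_prodMk_right (hSm n hn)
    · exact Eventually.of_forall fun n => Eventually.of_forall fun u => prob_le_one
    -- Distinct levels are at distance at least `1`, so convergence in probability tested at `ε = 1`
    -- controls disagreement.
    · filter_upwards [hA] with u hu
      refine tendsto_of_tendsto_of_tendsto_of_le_of_le tendsto_const_nhds (hu 1 one_pos)
        (fun _ => zero_le) fun n => measure_mono fun ω hω => ?_
      have hne : levelMap K Q (Xs (nn n (fun m => Xs m ω) 0) ω) u ≠ levelMap K Q (Xs 0 ω) u := hω
      change (1 : ENNReal) ≤ edist ((levelMap K Q (Xs (nn n (fun m => Xs m ω) 0) ω) u : ℕ) : ℝ)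
        ((levelMap K Q (Xs 0 ω) u : ℕ) : ℝ)
      rw [edist_dist, Nat.dist_cast_real, ← ENNReal.ofReal_one]
      exact ENNReal.ofReal_le_ofReal (Nat.pairwise_one_le_dist hne)
  have hlim' : Tendsto (fun n => ((P.prod unif) (S n)).toReal) atTop (𝓝 0) := by
    simpa [Function.comp_def] using (ENNReal.tendsto_toReal ENNReal.zero_ne_top).comp hlim
  refine tendsto_of_tendsto_of_tendsto_of_le_of_le' tendsto_const_nhds hlim'
    (Eventually.of_forall fun n => integral_nonneg fun ω => abs_nonneg _) ?_
  filter_upwards [eventually_ge_atTop 2] with n hn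
  have hmd : Measurable fun ω => |Q b (Xs (nn n (fun m => Xs m ω) 0) ω) - Q b (Xs 0 ω)| :=
    ((measurable_weight_nn hXs (hQ b hb) hn).sub ((hQ b hb).comp (hXs 0))).abs
  rw [integral_eq_lintegral_of_nonneg_ae (Eventually.of_forall fun ω => abs_nonneg _)
    hmd.aestronglyMeasurable]
  refine ENNReal.toReal_mono (measure_ne_top _ _) ?_
  rw [Measure.prod_apply (hSm n hn)]
  refine lintegral_mono_ae ?_
  filter_upwards [hw] with ω hω
  -- `Q b x` is the uniform measure of the `u` with level `b` at `x`; such a `u` has level `b` at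
  -- `x'` too unless the levels disagree.
  have hle : ∀ x x' : H, IsWeight K Q x → IsWeight K Q x' →
      Q b x ≤ Q b x' + unif.real {u | levelMap K Q x u ≠ levelMap K Q x' u} := by
    intro x x' hx hx'
    have e : ∀ x, IsWeight K Q x → unif.real {u | levelMap K Q x u = b} = Q b x := fun x hx => by
      rw [measureReal_def, hx.unif_levelMap hb, ENNReal.toReal_ofReal (hx.1 b hb)]
    rw [← e x hx, ← e x' hx']
    refine le_trans (measureReal_mono ?_) (measureReal_union_le _ _)
    intro u hu
    have hu' : levelMap K Q x u = b := hu
    by_cases h : levelMap K Q x u = levelMap K Q x' u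
    · exact Or.inl (h.symm.trans hu')
    · exact Or.inr h
  have hx := hω (nn n (fun m => Xs m ω) 0)
  have h1 := hle _ _ hx (hω 0)
  have h2 := hle _ _ (hω 0) hx
  simp_rw [ne_comm (a := levelMap K Q (Xs 0 ω) _)] at h2
  refine ENNReal.ofReal_le_of_le_toReal ?_
  change _ ≤ unif.real {u | levelMap K Q (Xs (nn n (fun m => Xs m ω) 0) ω) u
    ≠ levelMap K Q (Xs 0 ω) u}
  rw [abs_le]
  constructor <;> linarith

end NearestNeighbour

/-! ### Passage to the limit. -/

section Limit

variable {Ω H : Type*} [MeasurableSpace Ω] [MetricSpace H] [SecondCountableTopology H]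
  [MeasurableSpace H] [BorelSpace H] {P : Measure Ω} [IsProbabilityMeasure P]
  {Xs : ℕ → Ω → H} {Ys : ℕ → Ω → ℕ} {K : ℕ} {Q : ℕ → H → ℝ}

/-- Since `0 ≤ Q a ≤ 1`, the distance between mean and limit is at most the `L¹` distance of the
`b`-weights at the point and at its neighbour. -/
lemma tendsto_integral_pHat (hXs : ∀ i, Measurable (Xs i)) (hYs : ∀ i, Measurable (Ys i))
    (hindep : iIndepFun (fun i ω => (Xs i ω, Ys i ω)) P) {ν : Measure (H × ℕ)}
    (hν : ∀ i, P.map (fun ω => (Xs i ω, Ys i ω)) = ν)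
    (huniq : ∀ n : ℕ, 2 ≤ n → ∀ᵐ ω ∂P, UniqueNearest n (fun i => Xs i ω))
    (hQ : ∀ k ∈ Finset.Icc 1 K, Measurable (Q k))
    (hw : ∀ᵐ ω ∂P, ∀ i, IsWeight K Q (Xs i ω))
    (hd : ∀ k ∈ Finset.Icc 1 K, IsLevelDensity ν k fun x => ENNReal.ofReal (Q k x))
    {a b : ℕ} (ha : a ∈ Finset.Icc 1 K) (hb : b ∈ Finset.Icc 1 K)
    (hL1 : Tendsto (fun n => ∫ ω, |Q b (Xs (nn n (fun m => Xs m ω) 0) ω) - Q b (Xs 0 ω)| ∂P)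
      atTop (𝓝 0)) :
    Tendsto (fun n => ∫ ω, pHat n (fun i => Xs i ω) (fun i => Ys i ω) a b ∂P) atTop
      (𝓝 (∫ ω, Q a (Xs 0 ω) * Q b (Xs 0 ω) ∂P)) := by
  rw [tendsto_iff_dist_tendsto_zero]
  refine tendsto_of_tendsto_of_tendsto_of_le_of_le' tendsto_const_nhds hL1
    (Eventually.of_forall fun n => dist_nonneg) ?_
  filter_upwards [eventually_ge_atTop 2] with n hn
  have hma : Measurable fun ω => Q a (Xs 0 ω) := (hQ a ha).comp (hXs 0)
  have hmb : Measurable fun ω => Q b (Xs 0 ω) := (hQ b hb).comp (hXs 0)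
  have hmN := measurable_weight_nn hXs (hQ b hb) hn
  have hbound : ∀ {f : Ω → ℝ}, Measurable f → (∀ᵐ ω ∂P, |f ω| ≤ 1) → Integrable f P :=
    fun hf h => Integrable.of_bound hf.aestronglyMeasurable 1 h
  have h1 : Integrable (fun ω => Q a (Xs 0 ω) * Q b (Xs (nn n (fun m => Xs m ω) 0) ω)) P :=
    hbound (hma.mul hmN) (by
      filter_upwards [hw] with ω hω
      have e1 := (hω 0).mem_Icc ha
      have e2 := (hω (nn n (fun m => Xs m ω) 0)).mem_Icc hb
      rw [abs_of_nonneg (mul_nonneg e1.1 e2.1)]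
      exact mul_le_one₀ e1.2 e2.1 e2.2)
  have h2 : Integrable (fun ω => Q a (Xs 0 ω) * Q b (Xs 0 ω)) P :=
    hbound (hma.mul hmb) (by
      filter_upwards [hw] with ω hω
      have e1 := (hω 0).mem_Icc ha
      have e2 := (hω 0).mem_Icc hb
      rw [abs_of_nonneg (mul_nonneg e1.1 e2.1)]
      exact mul_le_one₀ e1.2 e2.1 e2.2)
  have h3 : Integrable (fun ω => |Q b (Xs (nn n (fun m => Xs m ω) 0) ω) - Q b (Xs 0 ω)|) P :=
    hbound (hmN.sub hmb).abs (by
      filter_upwards [hw] with ω hω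
      have e1 := (hω (nn n (fun m => Xs m ω) 0)).mem_Icc hb
      have e2 := (hω 0).mem_Icc hb
      rw [abs_abs, abs_le]
      constructor <;> linarith [e1.1, e1.2, e2.1, e2.2])
  have hval : ∫ ω, pHat n (fun i => Xs i ω) (fun i => Ys i ω) a b ∂P =
      ∫ ω, Q a (Xs 0 ω) * Q b (Xs (nn n (fun m => Xs m ω) 0) ω) ∂P := by
    rw [integral_pHat hXs hYs hindep hν hn (huniq n hn), measureReal_def,
      measure_level_nn_zero hXs hYs hindep hν (hd a ha) (hd b hb) hn,
      integral_eq_lintegral_of_nonneg_ae (by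
        filter_upwards [hw] with ω hω
        exact mul_nonneg ((hω 0).1 a ha) ((hω _).1 b hb)) h1.aestronglyMeasurable]
    congr 1
    refine lintegral_congr_ae ?_
    filter_upwards [hw] with ω hω
    rw [ENNReal.ofReal_mul ((hω 0).1 a ha)]
  rw [hval, Real.dist_eq, ← integral_sub h1 h2]
  refine (abs_integral_le_integral_abs).trans ?_
  refine integral_mono_ae (h1.sub h2).abs h3 ?_
  filter_upwards [hw] with ω hω
  have e1 := (hω 0).mem_Icc ha
  rw [← mul_sub, abs_mul, abs_of_nonneg e1.1]
  exact mul_le_of_le_one_left (abs_nonneg _) e1.2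

/-- Continuity of the normalised `χ²`-statistic, where summands with denominator `0` are constant
along the sequence. -/
lemma tendsto_cramerV {p : ℕ → ℕ → ℕ → ℝ} {r s : ℕ → ℕ → ℝ} {p₀ : ℕ → ℕ → ℝ} {r₀ s₀ : ℕ → ℝ}
    (hp : ∀ i ∈ Finset.Icc 1 K, ∀ j ∈ Finset.Icc 1 K,
      Tendsto (fun n => p n i j) atTop (𝓝 (p₀ i j)))
    (hr : ∀ i ∈ Finset.Icc 1 K, Tendsto (fun n => r n i) atTop (𝓝 (r₀ i)))
    (hs : ∀ j ∈ Finset.Icc 1 K, Tendsto (fun n => s n j) atTop (𝓝 (s₀ j)))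
    (hr0 : ∀ i ∈ Finset.Icc 1 K, r₀ i = 0 → ∀ n, r n i = 0)
    (hs0 : ∀ j ∈ Finset.Icc 1 K, s₀ j = 0 → ∀ n, s n j = 0) :
    Tendsto (fun n => cramerV K (p n) (r n) (s n)) atTop (𝓝 (cramerV K p₀ r₀ s₀)) := by
  unfold cramerV
  refine Tendsto.const_mul _ (tendsto_finsetSum _ fun i hi => tendsto_finsetSum _ fun j hj => ?_)
  by_cases h0 : r₀ i * s₀ j = 0
  · have : ∀ n, r n i * s n j = 0 := by
      intro n
      rcases mul_eq_zero.1 h0 with h | h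
      · rw [hr0 i hi h n, zero_mul]
      · rw [hs0 j hj h n, mul_zero]
    simp [h0, this]
  · exact (((hp i hi j hj).sub ((hr i hi).mul (hs j hj))).pow 2).div ((hr i hi).mul (hs j hj)) h0

end Limit

end NNDependence

/-! ### Assembly of the theorem. -/

theorem mainTheorem4
    {H : Type*} [MetricSpace H] [TopologicalSpace.SeparableSpace H]
    [MeasurableSpace H] [BorelSpace H]
    -- the pair `(X, Y)`; `Y` has levels `1, …, K`
    {Ω₀ : Type*} [MeasurableSpace Ω₀] (P₀ : Measure Ω₀) [IsProbabilityMeasure P₀]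
    (K : ℕ) (hK : 2 ≤ K)
    (X : Ω₀ → H) (Y : Ω₀ → ℕ) (hX : Measurable X) (hY : Measurable Y)
    (hYlevels : ∀ᵐ ω ∂P₀, Y ω ∈ Finset.Icc 1 K)
    (Q : ℕ → H → ℝ) (hQ : NNDependence.IsCondProb P₀ X Y K Q)
    -- an i.i.d. sample from the distribution of `(X, Y)`
    {Ω : Type*} [MeasurableSpace Ω] (P : Measure Ω) [IsProbabilityMeasure P]
    (Xs : ℕ → Ω → H) (Ys : ℕ → Ω → ℕ)
    (hXs : ∀ i, Measurable (Xs i)) (hYs : ∀ i, Measurable (Ys i))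
    (hindep : iIndepFun (fun i ω => (Xs i ω, Ys i ω)) P)
    (hident : ∀ i, IdentDistrib (fun ω => (Xs i ω, Ys i ω)) (fun ω => (X ω, Y ω)) P P₀)
    -- almost surely, nearest neighbours are unique
    (huniq : ∀ n : ℕ, 2 ≤ n → ∀ᵐ ω ∂P, NNDependence.UniqueNearest n (fun i => Xs i ω))
    (hassumption : NNDependence.CondA P K Q Xs ∨ NNDependence.CondB (P₀.map X) K Q)
    (k : ℕ → ℝ)
    (hk_sum : Summable fun n : ℕ =>
      P.real {ω | k n ≤ (NNDependence.maxInDegree n (fun i => Xs i ω) : ℝ)})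
    (hk_mul : Tendsto (fun n : ℕ =>
      k n * P.real {ω | k n ≤ (NNDependence.maxInDegree n (fun i => Xs i ω) : ℝ)})
      atTop (𝓝 0))
    (hk_rate : k =o[atTop] fun n : ℕ => Real.sqrt ((n : ℝ) / Real.log (n : ℝ))) :
    ∀ᵐ ω ∂P, Tendsto
      (fun n : ℕ => NNDependence.psiHat K n (fun i => Xs i ω) (fun i => Ys i ω))
      atTop (𝓝 (NNDependence.psi K (P₀.map X) Q)) := by
  have : SecondCountableTopology H := UniformSpace.secondCountable_of_separable H
  have hZ₀ : Measurable fun ω => (X ω, Y ω) := hX.prodMk hY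
  have hZ : ∀ i, Measurable fun ω => (Xs i ω, Ys i ω) := fun i => (hXs i).prodMk (hYs i)
  set μ : Measure H := P₀.map X
  have : IsProbabilityMeasure μ := Measure.isProbabilityMeasure_map hX.aemeasurable
  have hν : ∀ i, P.map (fun ω => (Xs i ω, Ys i ω)) = P₀.map fun ω => (X ω, Y ω) :=
    fun i => (hident i).map_eq
  have hμ : ∀ i, P.map (Xs i) = μ := by
    intro i
    have h1 : P.map (Xs i) = (P.map fun ω => (Xs i ω, Ys i ω)).map Prod.fst := by
      rw [Measure.map_map measurable_fst (hZ i)]; rfl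
    rw [h1, hν i, Measure.map_map measurable_fst hZ₀]; rfl
  have hindepX : iIndepFun Xs P := hindep.comp (fun _ => Prod.fst) fun _ => measurable_fst
  have hQm : ∀ j ∈ Finset.Icc 1 K, Measurable (Q j) := fun j hj => (hQ j hj).1
  have hw : ∀ᵐ x ∂μ, NNDependence.IsWeight K Q x := hQ.ae_isWeight hX hY hYlevels
  have hwX : ∀ᵐ ω ∂P, ∀ i, NNDependence.IsWeight K Q (Xs i ω) :=
    ae_all_iff.2 fun i => ae_of_ae_map (hXs i).aemeasurable (by rw [hμ i]; exact hw)
  have hd : ∀ j ∈ Finset.Icc 1 K, NNDependence.IsLevelDensity (P₀.map fun ω => (X ω, Y ω)) j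
      fun x => ENNReal.ofReal (Q j x) := fun j hj => hQ.isLevelDensity hX hY hw hj
  have hL1 : ∀ b ∈ Finset.Icc 1 K, Tendsto (fun n => ∫ ω,
      |Q b (Xs (NNDependence.nn n (fun m => Xs m ω) 0) ω) - Q b (Xs 0 ω)| ∂P) atTop (𝓝 0) := by
    intro b hb
    rcases hassumption with hA | hB
    · exact NNDependence.tendsto_integral_abs_sub_of_condA hXs hQm hwX hA hb
    · exact NNDependence.tendsto_integral_abs_sub_of_condB hXs hindepX hμ hQm hwX hB hb
  have hconv : ∀ᵐ ω ∂P, ∀ a ∈ Finset.Icc 1 K, ∀ b ∈ Finset.Icc 1 K,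
      Tendsto (fun n => NNDependence.pHat n (fun i => Xs i ω) (fun i => Ys i ω) a b) atTop
        (𝓝 (∫ x, Q a x * Q b x ∂μ)) := by
    simp only [Finset.eventually_all]
    intro a ha b hb
    have hlim : ∫ x, Q a x * Q b x ∂μ = ∫ ω, Q a (Xs 0 ω) * Q b (Xs 0 ω) ∂P := by
      rw [← hμ 0, integral_map (hXs 0).aemeasurable
        ((hQm a ha).fun_mul (hQm b hb)).aestronglyMeasurable]
    rw [hlim]
    exact NNDependence.ae_tendsto_pHat hXs hYs hindep hν hk_sum hk_rate a b
      (NNDependence.tendsto_integral_pHat hXs hYs hindep hν huniq hQm hwX hd ha hb (hL1 b hb))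
  -- A level of probability zero almost surely never appears in the sample, so its empirical
  -- marginals vanish for every `n`. This settles the summands with denominator `0`.
  have hnull : ∀ᵐ ω ∂P, ∀ a ∈ Finset.Icc 1 K, ∫ x, Q a x ∂μ = 0 → ∀ i, Ys i ω ≠ a := by
    rw [Finset.eventually_all]
    intro a ha
    by_cases h0 : ∫ x, Q a x ∂μ = 0
    · have hae : ∀ i, ∀ᵐ ω ∂P, Ys i ω ≠ a := by
        intro i
        have hset : MeasurableSet {z : H × ℕ | z.2 = a} :=
          measurableSet_eq_fun measurable_snd measurable_const
        have h1 := (hd a ha).2 (fun _ => 1) measurable_const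
        simp only [one_mul] at h1
        have hQ1 : Measurable fun x => ENNReal.ofReal (Q a x) := (hQm a ha).ennreal_ofReal
        have h2 : ∫⁻ z, ENNReal.ofReal (Q a z.1) ∂(P₀.map fun ω => (X ω, Y ω)) = 0 := by
          have hQ2 : Measurable fun z : H × ℕ => ENNReal.ofReal (Q a z.1) :=
            hQ1.comp measurable_fst
          rw [lintegral_map hQ2 hZ₀, ← lintegral_map hQ1 hX,
            ← ofReal_integral_eq_lintegral_ofReal (NNDependence.integrable_weight hQm hw ha)
              (by filter_upwards [hw] with x hx; exact hx.1 a ha), h0, ENNReal.ofReal_zero]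
        have h3 : (P₀.map fun ω => (X ω, Y ω)) {z : H × ℕ | z.2 = a} = 0 := by
          rw [← lintegral_indicator_one hset, ← h2, ← h1]
          refine lintegral_congr fun z => ?_
          simp [Set.indicator_apply]
        rw [← hν i, Measure.map_apply (hZ i) hset] at h3
        exact measure_eq_zero_iff_ae_notMem.1 h3
      filter_upwards [ae_all_iff.2 hae] with ω hω _ using hω
    · exact Eventually.of_forall fun ω h => absurd h h0
  -- The weights sum to `1`, so summing the limiting cells yields the marginals of the coupling.
  have hmarg : ∀ a ∈ Finset.Icc 1 K,
      ∑ b ∈ Finset.Icc 1 K, ∫ x, Q a x * Q b x ∂μ = ∫ x, Q a x ∂μ := by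
    intro a ha
    rw [← integral_finsetSum _ fun b hb => NNDependence.integrable_weight_mul hQm hw ha hb]
    refine integral_congr_ae ?_
    filter_upwards [hw] with x hx
    rw [← Finset.mul_sum, hx.2, mul_one]
  have hpsi : NNDependence.psi K μ Q = NNDependence.cramerV K
      (fun i j => ∫ x, Q i x * Q j x ∂μ) (fun i => ∫ x, Q i x ∂μ) (fun j => ∫ x, Q j x ∂μ) := by
    unfold NNDependence.psi NNDependence.cramerV
    congr 1
    refine Finset.sum_congr rfl fun i hi => Finset.sum_congr rfl fun j hj => ?_
    beta_reduce
    rw [NNDependence.couplingLaw_cell hQm hw hi hj, NNDependence.couplingLaw_fst hQm hw hi,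
      NNDependence.couplingLaw_snd hQm hw hj]
  rw [hpsi]
  filter_upwards [hconv, hnull] with ω hω hω0
  refine NNDependence.tendsto_cramerV hω (fun i hi => ?_) (fun j hj => ?_) (fun i hi h0 n => ?_)
    fun j hj h0 n => ?_
  · rw [← hmarg i hi]
    exact tendsto_finsetSum _ fun l hl => hω i hi l hl
  · rw [← hmarg j hj]
    simp_rw [mul_comm (Q j _)]
    exact tendsto_finsetSum _ fun l hl => hω l hl j hj
  · refine Finset.sum_eq_zero fun l _ => ?_
    simp [NNDependence.pHat, hω0 i hi h0]
  · refine Finset.sum_eq_zero fun l _ => ?_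
    simp [NNDependence.pHat, hω0 j hj h0]
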